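/- Conventions. Let $R$ be a commutative Artinian ring; an Artin $R$-algebra is an $R$-algebra that is finitely generated as an $R$-module. Modules over Artin algebras are finitely generated, and left unless stated otherwise. For an Artin algebra $A$ and an $A$-module $N$ let ${}^\perp N$ be the class of $A$-modules $X$ with $\operatorname{Ext}^i_A(X,N)=0$ for all $i\ge 1$; for a class $\mathcal S$ of $A$-modules let $\mathcal S^\perp$ be the class of $A$-modules $N$ with $\operatorname{Ext}^i_A(X,N)=0$ for all $X\in\mathcal S$ and $i\ge 1$. Put $X^*=\operatorname{Hom}_A(X,A)$, a right $A$-module. An $A$-module $X$ is *semi-Gorenstein-projective* if $X\in{}^\perp({}_AA)$; it is *Gorenstein-projective* if $X\in{}^\perp({}_AA)$, $X^*\in{}^\perp(A_A)$, and the canonical map $X\to X^{**}$ is bijective; it is *torsionless* if it is isomorphic to a submodule of a projective module. The algebra $A$ is *(left) weakly Gorenstein* if every semi-Gorenstein-projective left $A$-module is Gorenstein-projective, and *Gorenstein* if $\operatorname{inj.dim}{}_AA<\infty$ and $\operatorname{inj.dim}A_A<\infty$. Let $D=\operatorname{Hom}_R(-,J)$, where $J$ is the injective envelope of the $R$-module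 $R/\operatorname{rad}R$. **Theorem 1.2.** Let $A$ and $B$ be Artin $R$-algebras, and let $M$ be an $A$-$B$-bimodule, finitely generated over $R$, on which $R$ acts centrally, so that $\Lambda=\begin{pmatrix}A&M\\0&B\end{pmatrix}$ is an Artin algebra. Identify a left $\Lambda$-module $L$ with the triple $(X,Y,\varphi)$, where $X=e_1L$ is a left $A$-module, $Y=e_2L$ is a left $B$-module ($e_1,e_2$ being the diagonal idempotents), and $\varphi:M\otimes_BY\to X$ is the $A$-linear map induced by the action of $M$ on $L$. Call $L$ *monic with respect to $M$* if $\varphi$ is injective. Assume $\operatorname{proj.dim}{}_AM<\infty$. 1. If $\operatorname{proj.dim}M_B<\infty$ and $D(M_B)\in({}^\perp({}_BB))^\perp$, then $\Lambda$ is weakly Gorenstein if and only if every semi-Gorenstein-projective $\Lambda$-module is monic with respect to $M$, and $A$ and $B$ are weakly Gorenstein. 2. If $\operatorname{proj.dim}M_B<\infty$ and $B$ is a Gorenstein algebra, then $\Lambda$ is weakly Gorenstein if and only if every semi-Gorenstein-projective $\Lambda$-module is monic with respect to $M$, and $A$ is weakly Gorenstein. 3. If ${}_AM$ is torsionless and $M_B$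 is projective, then $\Lambda$ is weakly Gorenstein if and only if $A$ and $B$ are weakly Gorenstein. In particular, this equivalence holds if ${}_AM$ and $M_B$ are projective. -/

import Mathlib

open CategoryTheory

open scoped TensorProduct

universe u

/-! ### Orthogonal classes, Gorenstein-projective modules, weakly Gorenstein algebras

Left modules over a ring `A` are objects of `ModuleCat A`; right modules are left modules over
`Aᵐᵒᵖ`. The finite generation of modules is always written out. -/

section Homological

/-- `⊥N`: the finitely generated `A`-modules `X` with `Ext_A^i(X, N) = 0` for all `i ≥ 1`. -/
def leftPerp (A : Type u) [Ring A] (N : ModuleCat.{u} A) : Set (ModuleCat.{u} A) :=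
  {X | Module.Finite A X ∧ ∀ i : ℕ, 1 ≤ i → Subsingleton (Abelian.Ext X N i)}

/-- `S^⊥`: the `A`-modules `N` with `Ext_A^i(X, N) = 0` for all `X ∈ S` and all `i ≥ 1`. -/
def rightPerp (A : Type u) [Ring A] (S : Set (ModuleCat.{u} A)) : Set (ModuleCat.{u} A) :=
  {N | ∀ X ∈ S, ∀ i : ℕ, 1 ≤ i → Subsingleton (Abelian.Ext X N i)}

/-- `X` is semi-Gorenstein-projective: `X` is finitely generated and lies in `⊥A`. -/
def IsSemiGorensteinProjective (A : Type u) [Ring A] (X : ModuleCat.{u} A) : Prop :=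
  X ∈ leftPerp A (ModuleCat.of A A)

/-- The canonical map `φ_X : X → X^{**}`, `φ_X(x)(f) = f(x)`. Here `X^* = Hom_A(X, A)` is a right
`A`-module through the right multiplication of `A`, and `X^{**} = Hom_{A^op}(X^*, A)`. -/
def bidualMap (A : Type u) [Ring A] (X : Type u) [AddCommGroup X] [Module A X] :
    X →ₗ[A] ((X →ₗ[A] A) →ₗ[Aᵐᵒᵖ] A) where
  toFun x :=
    { toFun := fun f => f x
      map_add' := fun _ _ => rfl
      map_smul' := fun _ _ => rfl }
  map_add' x y := by
    ext f
    exact f.map_add x y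
  map_smul' a x := by
    ext f
    exact f.map_smul a x

/-- `X` is Gorenstein-projective (totally reflexive, of G-dimension zero): `X` and its dual `X^*`
are semi-Gorenstein-projective, and `X` is reflexive. -/
def IsGorensteinProjective (A : Type u) [Ring A] (X : ModuleCat.{u} A) : Prop :=
  IsSemiGorensteinProjective A X ∧
    ModuleCat.of Aᵐᵒᵖ (X →ₗ[A] A) ∈ leftPerp Aᵐᵒᵖ (ModuleCat.of Aᵐᵒᵖ A) ∧
    Function.Bijective (bidualMap A X)

/-- `A` is (left) weakly Gorenstein: every semi-Gorenstein-projective left `A`-module is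
Gorenstein-projective. -/
def IsWeaklyGorenstein (A : Type u) [Ring A] : Prop :=
  ∀ X : ModuleCat.{u} A, IsSemiGorensteinProjective A X → IsGorensteinProjective A X

/-- `A` is Gorenstein: the injective dimensions of `A` as a left and as a right `A`-module are
finite. -/
def IsGorensteinAlgebra (A : Type u) [Ring A] : Prop :=
  injectiveDimension (ModuleCat.of A A) < ⊤ ∧ injectiveDimension (ModuleCat.of Aᵐᵒᵖ A) < ⊤

/-- `X` is torsionless: it is isomorphic to a submodule of a projective module. -/
def IsTorsionless (A : Type u) [Ring A] (X : Type u) [AddCommGroup X] [Module A X] : Prop :=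
  ∃ (P : ModuleCat.{u} A) (f : X →ₗ[A] P), Module.Projective A P ∧ Function.Injective f

end Homological

/-! ### Injective envelopes and the duality of an Artin algebra -/

section Duality

/-- `ι : N → J` is an injective envelope: `J` is injective and `ι` is an essential monomorphism. -/
structure IsInjectiveEnvelope {R : Type u} [Ring R] {N J : Type u} [AddCommGroup N] [Module R N]
    [AddCommGroup J] [Module R J] (ι : N →ₗ[R] J) : Prop where
  injective_module : Module.Injective R J
  injective_map : Function.Injective ι
  essential : ∀ U : Submodule R J, U ≠ ⊥ → U ⊓ LinearMap.range ι ≠ ⊥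

/-- Every module has an injective envelope. -/
theorem exists_isInjectiveEnvelope (R : Type u) [Ring R] (N : Type u) [AddCommGroup N]
    [Module R N] :
    ∃ (J : ModuleCat.{u} R) (ι : N →ₗ[R] J), IsInjectiveEnvelope ι := by
  classical
  -- an embedding `j` of `N` into some injective module `I`
  let I : ModuleCat.{u} R := CategoryTheory.Injective.under (ModuleCat.of R N)
  let j : N →ₗ[R] I := (CategoryTheory.Injective.ι (ModuleCat.of R N)).hom
  have hj : Function.Injective j :=
    (ModuleCat.mono_iff_injective (CategoryTheory.Injective.ι (ModuleCat.of R N))).mp inferInstance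
  have hI : Module.Injective R I := by
    have : CategoryTheory.Injective (ModuleCat.of R I) :=
      inferInstanceAs (CategoryTheory.Injective (CategoryTheory.Injective.under (ModuleCat.of R N)))
    exact Module.injective_module_of_injective_object R I
  -- a maximal essential extension `E` of the image of `N` inside `I`
  let S : Set (Submodule R I) :=
    {T | LinearMap.range j ≤ T ∧ ∀ U ≤ T, U ≠ ⊥ → U ⊓ LinearMap.range j ≠ ⊥}
  have hS : LinearMap.range j ∈ S :=
    ⟨le_rfl, fun U hU hne => by rwa [inf_eq_left.mpr hU]⟩
  obtain ⟨E, -, hE⟩ := zorn_le_nonempty₀ S (fun c hc hchain y hy => by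
    refine ⟨sSup c, ⟨(hc hy).1.trans (le_sSup hy), fun U hU hne => ?_⟩, fun z hz => le_sSup hz⟩
    obtain ⟨x, hxU, hx0⟩ := Submodule.exists_mem_ne_zero_of_ne_bot hne
    obtain ⟨T, hT, hxT⟩ :=
      (Submodule.mem_sSup_of_directed ⟨y, hy⟩ hchain.directedOn).mp (hU hxU)
    have h1 := (hc hT).2 (Submodule.span R {x}) (by simpa using hxT) (by simpa using hx0)
    intro h2
    apply h1
    rw [eq_bot_iff, ← h2]
    exact inf_le_inf_right _ (by simpa using hxU)) _ hS
  -- a maximal submodule `C` with `E ∩ C = 0`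
  obtain ⟨C, -, hC⟩ := zorn_le_nonempty₀ {C : Submodule R I | Disjoint E C}
    (fun c hc hchain y hy => by
      refine ⟨sSup c, ?_, fun z hz => le_sSup hz⟩
      rw [Set.mem_ofPred_eq, Submodule.disjoint_def]
      intro x hxE hx
      obtain ⟨T, hT, hxT⟩ := (Submodule.mem_sSup_of_directed ⟨y, hy⟩ hchain.directedOn).mp hx
      exact Submodule.disjoint_def.mp (hc hT) x hxE hxT) ⊥ disjoint_bot_right
  have hCd : ∀ x ∈ E, x ∈ C → x = 0 := Submodule.disjoint_def.mp hC.prop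
  obtain ⟨h, hh⟩ := hI.out (C.mkQ.comp E.subtype) (by
    rw [injective_iff_map_eq_zero]
    intro x hx
    have hxC : (x : I) ∈ C := by simpa using hx
    exact Subtype.ext (hCd x x.2 hxC)) E.subtype
  have hh' : ∀ x ∈ E, h (C.mkQ x) = x := fun x hx => hh ⟨x, hx⟩
  have hEh : E ≤ LinearMap.range h := fun x hx => ⟨_, hh' x hx⟩
  have hmem : LinearMap.range h ∈ S := by
    refine ⟨hE.prop.1.trans hEh, fun U hU hne => ?_⟩
    obtain ⟨u, huU, hu0⟩ := Submodule.exists_mem_ne_zero_of_ne_bot hne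
    obtain ⟨q, rfl⟩ := hU huU
    obtain ⟨v, rfl⟩ := C.mkQ_surjective q
    have hnd : ¬ Disjoint E ((U.comap h).comap C.mkQ) := by
      intro hd
      have hle : C ≤ (U.comap h).comap C.mkQ := by
        intro c hc
        have : C.mkQ c = 0 := by simpa using hc
        simp [this]
      have hvC : v ∈ C := hC.le_of_ge hd hle huU
      apply hu0
      have : C.mkQ v = 0 := by simpa using hvC
      rw [this, map_zero]
    rw [Submodule.disjoint_def] at hnd
    push Not at hnd
    obtain ⟨x, hxE, hxU, hx0⟩ := hnd
    have hxU' : x ∈ U := by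
      have h3 : h (C.mkQ x) ∈ U := hxU
      rwa [hh' x hxE] at h3
    have h1 := hE.prop.2 (U ⊓ E) inf_le_right ((Submodule.ne_bot_iff _).mpr ⟨x, ⟨hxU', hxE⟩, hx0⟩)
    intro h2
    apply h1
    rw [eq_bot_iff, ← h2]
    exact inf_le_inf_right _ inf_le_left
  have hrange : LinearMap.range h ≤ E := hE.le_of_ge hmem hEh
  let r : I →ₗ[R] E := (h.comp C.mkQ).codRestrict E (fun x => hrange ⟨_, rfl⟩)
  have hr : ∀ x : E, r x = x := fun x => Subtype.ext (hh' x x.2)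
  refine ⟨ModuleCat.of R E, j.codRestrict E (fun n => hE.prop.1 ⟨n, rfl⟩), ⟨?_, ?_, ?_⟩⟩
  · constructor
    intro X Y _ _ _ _ f hf g
    obtain ⟨k, hk⟩ := hI.out f hf (E.subtype.comp g)
    refine ⟨r.comp k, fun x => ?_⟩
    have : k (f x) = (g x : I) := hk x
    rw [LinearMap.comp_apply, this]
    exact hr (g x)
  · intro a b hab
    exact hj (congrArg Subtype.val hab)
  · intro U hU
    have h1 := hE.prop.2 (U.map E.subtype) (Submodule.map_subtype_le E U) (by
      intro h0
      refine hU (Submodule.map_injective_of_injective E.injective_subtype ?_)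
      rw [h0, Submodule.map_bot])
    obtain ⟨x, ⟨⟨y, hyU, hyx⟩, ⟨n, hn⟩⟩, hx0⟩ := Submodule.exists_mem_ne_zero_of_ne_bot h1
    refine (Submodule.ne_bot_iff _).mpr ⟨y, ⟨hyU, ⟨n, Subtype.ext (hn.trans hyx.symm)⟩⟩, ?_⟩
    rintro rfl
    exact hx0 (by rw [← hyx, map_zero])

/-- The injective envelope of the `R`-module `R / rad R`, where `rad R` is the Jacobson radical. -/
noncomputable def topEnvelope (R : Type u) [CommRing R] : ModuleCat.{u} R :=
  (exists_isInjectiveEnvelope R (R ⧸ Ring.jacobson R)).choose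

/-- The embedding of `R / rad R` into its injective envelope. -/
noncomputable def topEnvelopeMap (R : Type u) [CommRing R] :
    (R ⧸ Ring.jacobson R) →ₗ[R] topEnvelope R :=
  (exists_isInjectiveEnvelope R (R ⧸ Ring.jacobson R)).choose_spec.choose

theorem isInjectiveEnvelope_topEnvelopeMap (R : Type u) [CommRing R] :
    IsInjectiveEnvelope (topEnvelopeMap R) :=
  (exists_isInjectiveEnvelope R (R ⧸ Ring.jacobson R)).choose_spec.choose_spec

/-- The duality `D(M) = Hom_R(M, J)`, where `J` is the injective envelope of `R / rad R`. -/
def ArtinDual (R : Type u) [CommRing R] (M : Type u) [AddCommGroup M] [Module R M] : Type u :=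
  M →ₗ[R] topEnvelope R

noncomputable instance (R : Type u) [CommRing R] (M : Type u) [AddCommGroup M] [Module R M] :
    AddCommGroup (ArtinDual R M) :=
  inferInstanceAs (AddCommGroup (M →ₗ[R] topEnvelope R))

/-- For a right module `M` over an `R`-algebra `B`, the left `B`-module structure
`(b f)(m) = f(m b)` on `D(M)`. -/
noncomputable instance ArtinDual.instModule (R B : Type u) [CommRing R] [Ring B] [Algebra R B]
    (M : Type u) [AddCommGroup M] [Module R M] [Module Bᵐᵒᵖ M] [IsScalarTower R Bᵐᵒᵖ M] :
    Module B (ArtinDual R M) where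
  smul b f := LinearMap.comp (f : M →ₗ[R] topEnvelope R)
    (DistribSMul.toLinearMap R M (MulOpposite.op b))
  one_smul f := LinearMap.ext fun m => by
    let g : M →ₗ[R] topEnvelope R := f
    exact congrArg g (one_smul Bᵐᵒᵖ m)
  mul_smul b c f := LinearMap.ext fun m => by
    let g : M →ₗ[R] topEnvelope R := f
    exact congrArg g (mul_smul (MulOpposite.op c) (MulOpposite.op b) m)
  smul_zero _ := rfl
  smul_add _ _ _ := rfl
  add_smul b c f := LinearMap.ext fun m => by
    let g : M →ₗ[R] topEnvelope R := f
    change g ((MulOpposite.op b + MulOpposite.op c) • m) =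
      g (MulOpposite.op b • m) + g (MulOpposite.op c • m)
    rw [add_smul, map_add]
  zero_smul f := LinearMap.ext fun m => by
    let g : M →ₗ[R] topEnvelope R := f
    change g ((0 : Bᵐᵒᵖ) • m) = 0
    rw [zero_smul, map_zero]

end Duality

/-! ### The triangular matrix ring of a bimodule -/

/-- Triangular matrices with diagonal entries `a : A`, `b : B` and upper right entry `m : M`. -/
@[ext]
structure TriMat (A M B : Type u) : Type u where
  a : A
  m : M
  b : B

namespace TriMat

section Ring

variable (A M B : Type u) [Ring A] [Ring B] [AddCommGroup M]

instance : Zero (TriMat A M B) := ⟨⟨0, 0, 0⟩⟩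
instance : One (TriMat A M B) := ⟨⟨1, 0, 1⟩⟩
instance : Add (TriMat A M B) := ⟨fun x y => ⟨x.a + y.a, x.m + y.m, x.b + y.b⟩⟩
instance : Neg (TriMat A M B) := ⟨fun x => ⟨-x.a, -x.m, -x.b⟩⟩

variable {A M B}

@[simp] theorem zero_a : (0 : TriMat A M B).a = 0 := rfl
@[simp] theorem zero_m : (0 : TriMat A M B).m = 0 := rfl
@[simp] theorem zero_b : (0 : TriMat A M B).b = 0 := rfl
@[simp] theorem one_a : (1 : TriMat A M B).a = 1 := rfl
@[simp] theorem one_m : (1 : TriMat A M B).m = 0 := rfl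
@[simp] theorem one_b : (1 : TriMat A M B).b = 1 := rfl
@[simp] theorem add_a (x y : TriMat A M B) : (x + y).a = x.a + y.a := rfl
@[simp] theorem add_m (x y : TriMat A M B) : (x + y).m = x.m + y.m := rfl
@[simp] theorem add_b (x y : TriMat A M B) : (x + y).b = x.b + y.b := rfl
@[simp] theorem neg_a (x : TriMat A M B) : (-x).a = -x.a := rfl
@[simp] theorem neg_m (x : TriMat A M B) : (-x).m = -x.m := rfl
@[simp] theorem neg_b (x : TriMat A M B) : (-x).b = -x.b := rfl

variable [Module A M] [Module Bᵐᵒᵖ M]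

instance : Mul (TriMat A M B) :=
  ⟨fun x y => ⟨x.a * y.a, x.a • y.m + MulOpposite.op y.b • x.m, x.b * y.b⟩⟩

@[simp] theorem mul_a (x y : TriMat A M B) : (x * y).a = x.a * y.a := rfl
@[simp] theorem mul_m (x y : TriMat A M B) :
    (x * y).m = x.a • y.m + MulOpposite.op y.b • x.m := rfl
@[simp] theorem mul_b (x y : TriMat A M B) : (x * y).b = x.b * y.b := rfl

/-- Matrix addition and multiplication make the triangular matrices a ring `Λ`. -/
instance [SMulCommClass A Bᵐᵒᵖ M] : Ring (TriMat A M B) where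
  add_assoc x y z := by ext <;> simp [add_assoc]
  zero_add x := by ext <;> simp
  add_zero x := by ext <;> simp
  add_comm x y := by ext <;> simp [add_comm]
  neg_add_cancel x := by ext <;> simp
  nsmul := nsmulRec
  zsmul := zsmulRec
  left_distrib x y z := by
    ext <;> simp [mul_add, add_smul, smul_add]
    abel
  right_distrib x y z := by
    ext <;> simp [add_mul, add_smul, smul_add]
    abel
  zero_mul x := by ext <;> simp
  mul_zero x := by ext <;> simp
  mul_assoc x y z := by
    ext
    · simp [mul_assoc]
    · simp [mul_smul, smul_add, smul_comm, add_assoc]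
    · simp [mul_assoc]
  one_mul x := by ext <;> simp
  mul_one x := by ext <;> simp

end Ring

section Modules

variable (A M B : Type u) [Ring A] [Ring B] [AddCommGroup M] [Module A M] [Module Bᵐᵒᵖ M]
  [SMulCommClass A Bᵐᵒᵖ M]
variable (L : Type u) [AddCommGroup L] [Module (TriMat A M B) L]

/-- The component `X = e₁L` of a `Λ`-module `L`, where `e₁ = diag(1, 0)`. -/
def topPart : AddSubgroup L where
  carrier := {x | (⟨1, 0, 0⟩ : TriMat A M B) • x = x}
  zero_mem' := smul_zero _
  add_mem' {x y} hx hy := by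
    simp only [Set.mem_ofPred_eq] at hx hy ⊢
    rw [smul_add, hx, hy]
  neg_mem' {x} hx := by
    simp only [Set.mem_ofPred_eq] at hx ⊢
    rw [smul_neg, hx]

/-- The component `Y = e₂L` of a `Λ`-module `L`, where `e₂ = diag(0, 1)`. -/
def botPart : AddSubgroup L where
  carrier := {y | (⟨0, 0, 1⟩ : TriMat A M B) • y = y}
  zero_mem' := smul_zero _
  add_mem' {x y} hx hy := by
    simp only [Set.mem_ofPred_eq] at hx hy ⊢
    rw [smul_add, hx, hy]
  neg_mem' {x} hx := by
    simp only [Set.mem_ofPred_eq] at hx ⊢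
    rw [smul_neg, hx]

/-- `e₁L` is a left `A`-module, `a` acting as `diag(a, 0)`. -/
instance : Module A (topPart A M B L) where
  smul a x := ⟨(⟨a, 0, 0⟩ : TriMat A M B) • (x : L), by
    change (⟨1, 0, 0⟩ : TriMat A M B) • (⟨a, 0, 0⟩ : TriMat A M B) • (x : L) = _
    rw [smul_smul]
    congr 1
    ext <;> simp⟩
  one_smul x := Subtype.ext x.2
  mul_smul a a' x := Subtype.ext <| by
    change (⟨a * a', 0, 0⟩ : TriMat A M B) • (x : L) =
      (⟨a, 0, 0⟩ : TriMat A M B) • (⟨a', 0, 0⟩ : TriMat A M B) • (x : L)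
    rw [smul_smul]
    congr 1
    ext <;> simp
  smul_zero a := Subtype.ext (smul_zero (⟨a, 0, 0⟩ : TriMat A M B))
  smul_add a x y := Subtype.ext (smul_add (⟨a, 0, 0⟩ : TriMat A M B) (x : L) (y : L))
  add_smul a a' x := Subtype.ext <| by
    change (⟨a + a', 0, 0⟩ : TriMat A M B) • (x : L) =
      (⟨a, 0, 0⟩ : TriMat A M B) • (x : L) + (⟨a', 0, 0⟩ : TriMat A M B) • (x : L)
    rw [← add_smul]
    congr 1
    ext <;> simp
  zero_smul x := Subtype.ext (zero_smul (TriMat A M B) (x : L))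

/-- `e₂L` is a left `B`-module, `b` acting as `diag(0, b)`. -/
instance : Module B (botPart A M B L) where
  smul b x := ⟨(⟨0, 0, b⟩ : TriMat A M B) • (x : L), by
    change (⟨0, 0, 1⟩ : TriMat A M B) • (⟨0, 0, b⟩ : TriMat A M B) • (x : L) = _
    rw [smul_smul]
    congr 1
    ext <;> simp⟩
  one_smul x := Subtype.ext x.2
  mul_smul b b' x := Subtype.ext <| by
    change (⟨0, 0, b * b'⟩ : TriMat A M B) • (x : L) =
      (⟨0, 0, b⟩ : TriMat A M B) • (⟨0, 0, b'⟩ : TriMat A M B) • (x : L)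
    rw [smul_smul]
    congr 1
    ext <;> simp
  smul_zero b := Subtype.ext (smul_zero (⟨0, 0, b⟩ : TriMat A M B))
  smul_add b x y := Subtype.ext (smul_add (⟨0, 0, b⟩ : TriMat A M B) (x : L) (y : L))
  add_smul b b' x := Subtype.ext <| by
    change (⟨0, 0, b + b'⟩ : TriMat A M B) • (x : L) =
      (⟨0, 0, b⟩ : TriMat A M B) • (x : L) + (⟨0, 0, b'⟩ : TriMat A M B) • (x : L)
    rw [← add_smul]
    congr 1
    ext <;> simp
  zero_smul x := Subtype.ext (zero_smul (TriMat A M B) (x : L))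

theorem coe_smul_topPart (a : A) (x : topPart A M B L) :
    ((a • x : topPart A M B L) : L) = (⟨a, 0, 0⟩ : TriMat A M B) • (x : L) := rfl

theorem coe_smul_botPart (b : B) (y : botPart A M B L) :
    ((b • y : botPart A M B L) : L) = (⟨0, 0, b⟩ : TriMat A M B) • (y : L) := rfl

end Modules

end TriMat

/-! ### Tensor products over a noncommutative ring, and monic modules -/

section BimoduleTensor

variable (A M B : Type u) [Ring A] [Ring B] [AddCommGroup M] [Module A M] [Module Bᵐᵒᵖ M]
variable (Y : Type u) [AddCommGroup Y] [Module B Y]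

/-- The `A`-submodule of `M ⊗_ℤ Y` generated by the elements `mb ⊗ y - m ⊗ by`. -/
def balancedRelations : Submodule A (M ⊗[ℤ] Y) :=
  Submodule.span A
    {t | ∃ (m : M) (b : B) (y : Y), t = (MulOpposite.op b • m) ⊗ₜ[ℤ] y - m ⊗ₜ[ℤ] (b • y)}

/-- The left `A`-module `M ⊗_B Y`, for an `A`-`B`-bimodule `M` and a left `B`-module `Y`. -/
abbrev BimoduleTensor : Type u := (M ⊗[ℤ] Y) ⧸ balancedRelations A M B Y

end BimoduleTensor

namespace TriMat

variable (A M B : Type u) [Ring A] [Ring B] [AddCommGroup M] [Module A M] [Module Bᵐᵒᵖ M]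
  [SMulCommClass A Bᵐᵒᵖ M]
variable (L : Type u) [AddCommGroup L] [Module (TriMat A M B) L]

/-- The biadditive map `M × e₂L → e₁L`, in which `m` acts as the matrix with upper right entry `m`
and all other entries zero. -/
def pairing : M →ₗ[A] botPart A M B L →ₗ[ℤ] topPart A M B L where
  toFun m := AddMonoidHom.toIntLinearMap
    { toFun := fun y => ⟨(⟨0, m, 0⟩ : TriMat A M B) • (y : L), by
        change (⟨1, 0, 0⟩ : TriMat A M B) • (⟨0, m, 0⟩ : TriMat A M B) • (y : L) = _
        rw [smul_smul]
        congr 1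
        ext <;> simp⟩
      map_zero' := Subtype.ext (smul_zero (⟨0, m, 0⟩ : TriMat A M B))
      map_add' := fun y y' =>
        Subtype.ext (smul_add (⟨0, m, 0⟩ : TriMat A M B) (y : L) (y' : L)) }
  map_add' m m' := LinearMap.ext fun y => Subtype.ext <| by
    change (⟨0, m + m', 0⟩ : TriMat A M B) • (y : L) =
      (⟨0, m, 0⟩ : TriMat A M B) • (y : L) + (⟨0, m', 0⟩ : TriMat A M B) • (y : L)
    rw [← add_smul]
    congr 1
    ext <;> simp
  map_smul' a m := LinearMap.ext fun y => Subtype.ext <| by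
    change (⟨0, a • m, 0⟩ : TriMat A M B) • (y : L) =
      (⟨a, 0, 0⟩ : TriMat A M B) • (⟨0, m, 0⟩ : TriMat A M B) • (y : L)
    rw [smul_smul]
    congr 1
    ext <;> simp

theorem coe_pairing (m : M) (y : botPart A M B L) :
    (pairing A M B L m y : L) = (⟨0, m, 0⟩ : TriMat A M B) • (y : L) := rfl

/-- The structure map `φ : M ⊗_B Y → X` of the `Λ`-module `L`, with `X = e₁L` and `Y = e₂L`. -/
noncomputable def structureMap :
    BimoduleTensor A M B (botPart A M B L) →ₗ[A] topPart A M B L :=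
  (balancedRelations A M B (botPart A M B L)).liftQ
    (TensorProduct.AlgebraTensorModule.lift (pairing A M B L)) <| by
      rw [balancedRelations, Submodule.span_le]
      rintro _ ⟨m, b, y, rfl⟩
      rw [SetLike.mem_coe, LinearMap.mem_ker, map_sub, sub_eq_zero,
        TensorProduct.AlgebraTensorModule.lift_tmul, TensorProduct.AlgebraTensorModule.lift_tmul]
      apply Subtype.ext
      rw [coe_pairing, coe_pairing, coe_smul_botPart, smul_smul]
      congr 1
      ext <;> simp

/-- The `Λ`-module `L`, seen as a triple `(X, Y, φ)`, is monic with respect to the bimodule `M`: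
`φ : M ⊗_B Y → X` is injective. -/
def IsMonic : Prop := Function.Injective (structureMap A M B L)

end TriMat

/-!
Write `Λ = TriMat A M B` and regard a `Λ`-module as a triple `(X, Y, φ)` with `φ : M ⊗_B Y → X`.

Weakly Gorenstein rings are those whose semi-Gorenstein-projective modules are torsionless
(`isWeaklyGorenstein_of_torsionless`): a torsionless semi-Gorenstein-projective module embeds into
some `Λ^n` such that all linear forms extend, the cokernel is again semi-Gorenstein-projective, and
iterating this embedding yields reflexivity and the vanishing of `Ext` for the dual. So the task is
to decide when linear forms separate the elements of semi-Gorenstein-projective modules.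

As a left module, `Λ` is an extension of `(0, B)` by `(A ⊕ M, 0)`, and `proj.dim _AM < ∞` reduces
the vanishing of `Ext` into `(M, 0)` to that into `(A, 0)`. Hence `L` is semi-Gorenstein-projective
if and only if `Y = e₂L` is and `Ext^i_Λ(L, (A, 0)) = 0` for `i ≥ 1`
(`TriMat.isSemiGorensteinProjective_iff`). The assumption `D(M) ∈ (⊥B)^⊥` says, through
`Hom_B(Y, D(M)) = D(M ⊗_B Y)`, that `M ⊗_B -` preserves short exact sequences whose third term is
semi-Gorenstein-projective (`BimoduleTensor.eq_zero_of_contract_eq_zero`). As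
`Y ↦ (M ⊗_B Y, Y)` is left adjoint to `L ↦ e₂L`, it follows that `(M ⊗_B Y, Y)` is
semi-Gorenstein-projective when `Y` is (`TriMat.isSemiGorensteinProjective_column`).

Let `Λ` be weakly Gorenstein. An embedding of `L` into `Λ^n` with semi-Gorenstein-projective
cokernel becomes an injection `M ⊗_B Y → M^n`, which factors through `φ`; so `L` is monic. The
algebras `A` and `B` are reached through the modules `(X, 0)` and `(M ⊗_B Y, Y)`. Conversely, a
monic semi-Gorenstein-projective `L` is an extension of `(coker φ, 0)` by `(M ⊗_B Y, Y)`. Over weakly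
Gorenstein `A` and `B` both modules are torsionless, and linear forms on the second one extend to
`L`; hence `L` is torsionless (`TriMat.isWeaklyGorenstein_of_isMonic`). This proves the first
part.

The other two parts are special cases. If `B` is Gorenstein, it is weakly Gorenstein
(`isWeaklyGorenstein_of_injectiveDimension_op_lt_top`), so that semi-Gorenstein-projective modules
are arbitrarily high syzygies of modules of the same kind; since `proj.dim M_B < ∞` makes the
injective dimension of `D(M)` finite, `D(M) ∈ (⊥B)^⊥`
(`ArtinDual.mem_rightPerp_of_isWeaklyGorenstein`). If `M_B` is projective, `D(M)` is injective; and
if moreover `_AM` is torsionless, so is `M ⊗_B Y`, and its linear forms extend along `φ` because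
`Ext¹_Λ(L, (A, 0)) = 0`, whence `φ` is injective (`TriMat.isMonic_of_isTorsionless`).
-/

/-! ### Vanishing of Ext in positive degrees -/

section ExtVanishes

universe v w v' u' w'

open Abelian

variable {C : Type u} [Category.{v} C] [Abelian C] [HasExt.{w} C]

/-- `Ext^i(X, N) = 0` for all `i ≥ 1`. -/
def ExtVanishes (X N : C) : Prop :=
  ∀ i : ℕ, 1 ≤ i → Subsingleton (Ext X N i)

theorem ExtVanishes.of_projective (X N : C) [Projective X] : ExtVanishes X N := by
  rintro (_ | i) hi
  · simp at hi
  · exact Ext.subsingleton_of_projective X N i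

theorem ExtVanishes.of_injective (X N : C) [Injective N] : ExtVanishes X N := by
  rintro (_ | i) hi
  · simp at hi
  · exact subsingleton_of_forall_eq 0 fun e => Ext.eq_zero_of_injective e

theorem ExtVanishes.of_isZero_right (X : C) {N : C} (hN : Limits.IsZero N) : ExtVanishes X N := by
  have : Injective N := hN.injective
  exact .of_injective X N

theorem Ext.subsingleton_of_retract_right {X N N' : C} (r : Retract N N') {i : ℕ}
    (h : Subsingleton (Ext X N' i)) : Subsingleton (Ext X N i) := by
  refine subsingleton_of_forall_eq 0 fun e => ?_
  have h1 : e.comp (Ext.mk₀ (r.i ≫ r.r)) (add_zero i) = e := by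
    rw [r.retract, Ext.comp_mk₀_id]
  rw [← h1, ← Ext.mk₀_comp_mk₀, ← Ext.comp_assoc_of_third_deg_zero,
    Subsingleton.elim (e.comp (Ext.mk₀ r.i) (add_zero i)) 0, Ext.zero_comp]

theorem ExtVanishes.of_retract_right {X N N' : C} (r : Retract N N') (h : ExtVanishes X N') :
    ExtVanishes X N := fun i hi => Ext.subsingleton_of_retract_right r (h i hi)

theorem ExtVanishes.of_iso_right {X N N' : C} (e : N ≅ N') (h : ExtVanishes X N') :
    ExtVanishes X N := h.of_retract_right (.ofIso e)

theorem ExtVanishes.of_iso_left {X X' N : C} (e : X ≅ X') (h : ExtVanishes X' N) :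
    ExtVanishes X N := by
  intro i hi
  have := h i hi
  refine subsingleton_of_forall_eq 0 fun x => ?_
  have h1 : (Ext.mk₀ (e.hom ≫ e.inv)).comp x (zero_add i) = x := by
    rw [e.hom_inv_id, Ext.mk₀_id_comp]
  rw [← h1, ← Ext.mk₀_comp_mk₀_assoc,
    Subsingleton.elim ((Ext.mk₀ e.inv).comp x (zero_add i)) 0, Ext.comp_zero]

section ShortExact

variable {S : ShortComplex C}

theorem Ext.subsingleton_X₁ (hS : S.ShortExact) {N : C} {i : ℕ} (h₂ : Subsingleton (Ext S.X₂ N i))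
    (h₃ : Subsingleton (Ext S.X₃ N (i + 1))) : Subsingleton (Ext S.X₁ N i) := by
  refine subsingleton_of_forall_eq 0 fun x => ?_
  obtain ⟨y, rfl⟩ := Ext.contravariant_sequence_exact₁ hS N x (add_comm 1 i)
    (Subsingleton.elim _ _)
  rw [Subsingleton.elim y 0, Ext.comp_zero]

theorem Ext.subsingleton_X₃ (hS : S.ShortExact) {N : C} {i : ℕ} (h₁ : Subsingleton (Ext S.X₁ N i))
    (h₂ : Subsingleton (Ext S.X₂ N (i + 1))) : Subsingleton (Ext S.X₃ N (i + 1)) := by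
  refine subsingleton_of_forall_eq 0 fun x => ?_
  obtain ⟨y, rfl⟩ := Ext.contravariant_sequence_exact₃ hS N x (Subsingleton.elim _ _)
    (add_comm 1 i)
  rw [Subsingleton.elim y 0, Ext.comp_zero]

/-- If `Ext¹(X₃, N) = 0`, then morphisms `X₁ ⟶ N` extend to `X₂`. -/
theorem exists_extension_of_subsingleton_ext_one (hS : S.ShortExact) {N : C}
    (h₃ : Subsingleton (Ext S.X₃ N 1))
    (f : S.X₁ ⟶ N) : ∃ g : S.X₂ ⟶ N, S.f ≫ g = f := by
  obtain ⟨y, hy⟩ := Ext.contravariant_sequence_exact₁ hS N (Ext.mk₀ f) (add_zero 1)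
    (Subsingleton.elim _ _)
  obtain ⟨g, rfl⟩ := (Ext.mk₀_bijective S.X₂ N).surjective y
  refine ⟨g, (Ext.mk₀_bijective S.X₁ N).injective ?_⟩
  rw [← hy, Ext.mk₀_comp_mk₀]

theorem subsingleton_ext_one_of_exists_extension (hS : S.ShortExact) {N : C}
    (h₂ : Subsingleton (Ext S.X₂ N 1))
    (h : ∀ f : S.X₁ ⟶ N, ∃ g : S.X₂ ⟶ N, S.f ≫ g = f) : Subsingleton (Ext S.X₃ N 1) := by
  refine subsingleton_of_forall_eq 0 fun x => ?_
  obtain ⟨y, rfl⟩ := Ext.contravariant_sequence_exact₃ hS N x (Subsingleton.elim _ _)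
    (add_zero 1)
  obtain ⟨f, rfl⟩ := (Ext.mk₀_bijective S.X₁ N).surjective y
  obtain ⟨g, rfl⟩ := h f
  rw [← Ext.mk₀_comp_mk₀, hS.extClass_comp_assoc]

theorem ExtVanishes.exists_extension (hS : S.ShortExact) {N : C}
    (h₃ : ExtVanishes S.X₃ N) (f : S.X₁ ⟶ N) :
    ∃ g : S.X₂ ⟶ N, S.f ≫ g = f :=
  exists_extension_of_subsingleton_ext_one hS (h₃ 1 le_rfl) f

theorem ExtVanishes.X₁ (hS : S.ShortExact) {N : C} (h₂ : ExtVanishes S.X₂ N)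
    (h₃ : ExtVanishes S.X₃ N) :
    ExtVanishes S.X₁ N :=
  fun i hi => Ext.subsingleton_X₁ hS (h₂ i hi) (h₃ (i + 1) (by lia))

theorem ExtVanishes.X₃ (hS : S.ShortExact) {N : C} (h₁ : ExtVanishes S.X₁ N)
    (h₂ : ExtVanishes S.X₂ N)
    (h : ∀ f : S.X₁ ⟶ N, ∃ g : S.X₂ ⟶ N, S.f ≫ g = f) : ExtVanishes S.X₃ N := by
  rintro (_ | _ | i) hi
  · simp at hi
  · exact subsingleton_ext_one_of_exists_extension hS (h₂ 1 le_rfl) h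
  · exact Ext.subsingleton_X₃ hS (h₁ (i + 1) (by lia)) (h₂ (i + 1 + 1) (by lia))

theorem Ext.subsingleton_right_X₁ (hS : S.ShortExact) {X : C} {i : ℕ}
    (h₂ : Subsingleton (Ext X S.X₂ (i + 1)))
    (h₃ : Subsingleton (Ext X S.X₃ i)) : Subsingleton (Ext X S.X₁ (i + 1)) := by
  refine subsingleton_of_forall_eq 0 fun x => ?_
  obtain ⟨y, rfl⟩ := Ext.covariant_sequence_exact₁ X hS x (Subsingleton.elim _ _) rfl
  rw [Subsingleton.elim y 0, Ext.zero_comp]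

theorem ExtVanishes.right_X₂ (hS : S.ShortExact) {X : C} (h₁ : ExtVanishes X S.X₁)
    (h₃ : ExtVanishes X S.X₃) :
    ExtVanishes X S.X₂ := by
  intro i hi
  have := h₁ i hi
  have := h₃ i hi
  refine subsingleton_of_forall_eq 0 fun x => ?_
  obtain ⟨y, rfl⟩ := Ext.covariant_sequence_exact₂ X hS x (Subsingleton.elim _ _)
  rw [Subsingleton.elim y 0, Ext.zero_comp]

theorem ExtVanishes.right_X₃ (hS : S.ShortExact) {X : C} (h₁ : ExtVanishes X S.X₁)
    (h₂ : ExtVanishes X S.X₂) :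
    ExtVanishes X S.X₃ := by
  intro i hi
  have := h₁ (i + 1) (by lia)
  have := h₂ i hi
  refine subsingleton_of_forall_eq 0 fun x => ?_
  obtain ⟨y, rfl⟩ := Ext.covariant_sequence_exact₃ X hS x rfl (Subsingleton.elim _ _)
  rw [Subsingleton.elim y 0, Ext.zero_comp]

end ShortExact

/-- Let `𝒮` be a class of objects each of which has a presentation `0 → K → P → X → 0` with `P`
projective, `K ∈ 𝒮`, and every morphism `K ⟶ N` extending to `P`. Then `Ext^i(X, N) = 0` for all
`X ∈ 𝒮` and `i ≥ 1`, by dimension shifting along these presentations. -/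
theorem ExtVanishes.of_presentations {N : C} (𝒮 : C → Prop)
    (h𝒮 : ∀ X, 𝒮 X → ∃ S : ShortComplex C, S.ShortExact ∧ S.X₃ = X ∧ Projective S.X₂ ∧ 𝒮 S.X₁ ∧
      ∀ f : S.X₁ ⟶ N, ∃ g : S.X₂ ⟶ N, S.f ≫ g = f)
    {X : C} (hX : 𝒮 X) : ExtVanishes X N := by
  suffices ∀ (i : ℕ) (X : C), 𝒮 X → Subsingleton (Ext X N (i + 1)) by
    rintro (_ | i) hi
    · simp at hi
    · exact this i X hX
  intro i
  induction i with
  | zero =>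
    intro X hX
    obtain ⟨S, hS, rfl, hP, -, h⟩ := h𝒮 X hX
    exact subsingleton_ext_one_of_exists_extension hS (Ext.subsingleton_of_projective _ _ _) h
  | succ i ih =>
    intro X hX
    obtain ⟨S, hS, rfl, hP, hK, -⟩ := h𝒮 X hX
    exact Ext.subsingleton_X₃ hS (ih _ hK) (Ext.subsingleton_of_projective _ _ _)

/-- For an adjunction `F ⊣ G` with `G` exact, the comparison `Ext^i(X, G N) ≅ Ext^i(F X, N)`, on
the level of vanishing. The functor `F` need not be exact: it is enough that it is exact on the
chosen projective presentations of the objects of the class `𝒮` containing `X`. -/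
theorem CategoryTheory.Adjunction.extVanishes_iff {D : Type u'} [Category.{v'} D] [Abelian D]
    [HasExt.{w'} D] {F : C ⥤ D} {G : D ⥤ C} (adj : F ⊣ G) [F.Additive]
    [G.PreservesEpimorphisms]
    (𝒮 : C → Prop)
    (h𝒮 : ∀ X, 𝒮 X → ∃ S : ShortComplex C, S.ShortExact ∧ S.X₃ = X ∧ Projective S.X₂ ∧ 𝒮 S.X₁ ∧
      (S.map F).ShortExact) {X : C} (hX : 𝒮 X) (N : D) :
    ExtVanishes (F.obj X) N ↔ ExtVanishes X (G.obj N) := by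
  suffices ∀ (i : ℕ) (X : C), 𝒮 X →
      (Subsingleton (Ext (F.obj X) N (i + 1)) ↔ Subsingleton (Ext X (G.obj N) (i + 1))) by
    constructor
    · rintro h (_ | i) hi
      · simp at hi
      · exact (this i X hX).1 (h _ hi)
    · rintro h (_ | i) hi
      · simp at hi
      · exact (this i X hX).2 (h _ hi)
  intro i
  induction i with
  | zero =>
    intro X hX
    obtain ⟨S, hS, rfl, hP, -, hF⟩ := h𝒮 X hX
    have hFP : Projective (S.map F).X₂ := adj.map_projective _ hP
    constructor
    · intro h
      refine subsingleton_ext_one_of_exists_extension hS (Ext.subsingleton_of_projective _ _ _)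
        fun f => ?_
      obtain ⟨g, hg⟩ := exists_extension_of_subsingleton_ext_one hF h
        ((adj.homEquiv _ _).symm f)
      refine ⟨adj.homEquiv _ _ g, ?_⟩
      refine (adj.homEquiv_naturality_left S.f g).symm.trans ?_
      exact (Equiv.eq_symm_apply _).1 hg
    · intro h
      refine subsingleton_ext_one_of_exists_extension hF (Ext.subsingleton_of_projective _ _ _)
        fun f => ?_
      obtain ⟨g, hg⟩ := exists_extension_of_subsingleton_ext_one hS h (adj.homEquiv _ _ f)
      refine ⟨(adj.homEquiv _ _).symm g, ?_⟩
      refine (adj.homEquiv_naturality_left_symm S.f g).symm.trans ?_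
      exact (Equiv.symm_apply_eq _).2 hg
  | succ i ih =>
    intro X hX
    obtain ⟨S, hS, rfl, hP, hK, hF⟩ := h𝒮 X hX
    have hFP : Projective (S.map F).X₂ := adj.map_projective _ hP
    constructor
    · intro h
      exact Ext.subsingleton_X₃ hS ((ih _ hK).1 (Ext.subsingleton_X₁ hF
        (Ext.subsingleton_of_projective _ _ _) h)) (Ext.subsingleton_of_projective _ _ _)
    · intro h
      exact Ext.subsingleton_X₃ hF ((ih _ hK).2 (Ext.subsingleton_X₁ hS
        (Ext.subsingleton_of_projective _ _ _) h)) (Ext.subsingleton_of_projective _ _ _)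

end ExtVanishes

/-! ### Vanishing of Ext for modules -/

section Modules

variable {A : Type u} [Ring A]

theorem shortExact_of_linearMap {K F X : Type u} [AddCommGroup K] [Module A K] [AddCommGroup F]
    [Module A F] [AddCommGroup X] [Module A X] {f : K →ₗ[A] F} {g : F →ₗ[A] X}
    (hf : Function.Injective f) (hfg : Function.Exact f g) (hg : Function.Surjective g) :
    (ModuleCat.shortComplexOfCompEqZero f g hfg.linearMap_comp_eq_zero).ShortExact :=
  ModuleCat.shortComplex_shortExact _ hfg hf hg

theorem ExtVanishes.exists_linearMap_extension {K F X N : Type u} [AddCommGroup K] [Module A K]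
    [AddCommGroup F] [Module A F] [AddCommGroup X] [Module A X] [AddCommGroup N] [Module A N]
    {f : K →ₗ[A] F} {g : F →ₗ[A] X} (hf : Function.Injective f) (hfg : Function.Exact f g)
    (hg : Function.Surjective g) (h : ExtVanishes (ModuleCat.of A X) (ModuleCat.of A N))
    (φ : K →ₗ[A] N) : ∃ ψ : F →ₗ[A] N, ψ ∘ₗ f = φ := by
  obtain ⟨ψ, hψ⟩ := ExtVanishes.exists_extension (shortExact_of_linearMap hf hfg hg) h
    (ModuleCat.ofHom φ)
  exact ⟨ψ.hom, congrArg ModuleCat.Hom.hom hψ⟩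

theorem ExtVanishes.of_exact_right {K F X N : Type u} [AddCommGroup K] [Module A K]
    [AddCommGroup F] [Module A F] [AddCommGroup X] [Module A X] [AddCommGroup N] [Module A N]
    {f : K →ₗ[A] F} {g : F →ₗ[A] X} (hf : Function.Injective f) (hfg : Function.Exact f g)
    (hg : Function.Surjective g) (hK : ExtVanishes (ModuleCat.of A K) (ModuleCat.of A N))
    (hF : ExtVanishes (ModuleCat.of A F) (ModuleCat.of A N))
    (h : ∀ φ : K →ₗ[A] N, ∃ ψ : F →ₗ[A] N, ψ ∘ₗ f = φ) :
    ExtVanishes (ModuleCat.of A X) (ModuleCat.of A N) := by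
  refine ExtVanishes.X₃ (shortExact_of_linearMap hf hfg hg) hK hF fun φ => ?_
  obtain ⟨ψ, hψ⟩ := h φ.hom
  exact ⟨ModuleCat.ofHom ψ, ModuleCat.hom_ext hψ⟩

/-- A finitely generated module over a left noetherian ring has a presentation by a finitely
generated free module with finitely generated kernel. -/
theorem exists_finite_free_presentation [IsNoetherianRing A] (X : Type u) [AddCommGroup X]
    [Module A X] [Module.Finite A X] :
    ∃ (n : ℕ) (g : (Fin n → A) →ₗ[A] X), Function.Surjective g ∧
      Module.Finite A (LinearMap.ker g) := by
  obtain ⟨n, g, hg⟩ := Module.Finite.exists_fin' A X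
  exact ⟨n, g, hg, inferInstance⟩

section ExactFunctor

universe w v' u'

variable {D : Type u'} [Category.{v'} D] [Abelian D] [HasExt.{w} D]
  (F : ModuleCat.{u} A ⥤ D) [F.Additive] [Limits.PreservesFiniteLimits F]
  [Limits.PreservesFiniteColimits F]

theorem ExtVanishes.map_prod {X : D} {N N' : Type u} [AddCommGroup N] [Module A N]
    [AddCommGroup N'] [Module A N'] (h : ExtVanishes X (F.obj (ModuleCat.of A N)))
    (h' : ExtVanishes X (F.obj (ModuleCat.of A N'))) :
    ExtVanishes X (F.obj (ModuleCat.of A (N × N'))) :=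
  ExtVanishes.right_X₂ ((shortExact_of_linearMap (f := LinearMap.inl A N N')
    (g := LinearMap.snd A N N') LinearMap.inl_injective .inl_snd
    LinearMap.snd_surjective).map_of_exact F) h h'

theorem ExtVanishes.map_pi {X : D} {N : Type u} [AddCommGroup N] [Module A N]
    (h : ExtVanishes X (F.obj (ModuleCat.of A N))) (n : ℕ) :
    ExtVanishes X (F.obj (ModuleCat.of A (Fin n → N))) := by
  induction n with
  | zero =>
    exact .of_isZero_right _ (F.map_isZero (ModuleCat.isZero_of_subsingleton _))
  | succ n ih =>
    exact (ExtVanishes.map_prod F h ih).of_iso_right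
      (F.mapIso (Fin.consLinearEquiv A fun _ : Fin (n + 1) => N).symm.toModuleIso)

theorem ExtVanishes.map_of_projective {X : D} (h : ExtVanishes X (F.obj (ModuleCat.of A A)))
    (P : Type u) [AddCommGroup P] [Module A P] [Module.Finite A P] [Module.Projective A P] :
    ExtVanishes X (F.obj (ModuleCat.of A P)) := by
  obtain ⟨n, g, hg⟩ := Module.Finite.exists_fin' A P
  obtain ⟨s, hs⟩ := Module.projective_lifting_property g LinearMap.id hg
  refine (ExtVanishes.map_pi F h n).of_retract_right (Retract.map ?_ F)
  exact ⟨ModuleCat.ofHom s, ModuleCat.ofHom g, ModuleCat.hom_ext hs⟩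

/-- If `Ext^i(X, F A) = 0` for all `i ≥ 1`, where `F` is an exact functor, then the same holds for
`F N` in place of `F A`, for each finitely generated module `N` of finite projective dimension. -/
theorem ExtVanishes.map_of_hasProjectiveDimensionLT [IsNoetherianRing A] {X : D}
    (h : ExtVanishes X (F.obj (ModuleCat.of A A))) (n : ℕ) (N : Type u) [AddCommGroup N]
    [Module A N] [Module.Finite A N] (hN : HasProjectiveDimensionLT (ModuleCat.of A N) (n + 1)) :
    ExtVanishes X (F.obj (ModuleCat.of A N)) := by
  induction n generalizing N with
  | zero =>
    have : Module.Projective A N := (IsProjective.iff_projective N).2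
      (projective_iff_hasProjectiveDimensionLT_one.2 hN)
    exact .map_of_projective F h N
  | succ n ih =>
    obtain ⟨m, g, hg, hK⟩ := exists_finite_free_presentation (A := A) N
    have hS := shortExact_of_linearMap (LinearMap.ker g).injective_subtype
      (LinearMap.exact_subtype_ker_map g) hg
    refine ExtVanishes.right_X₃ (hS.map_of_exact F) (ih _ ?_) (.map_pi F h m)
    exact (hS.hasProjectiveDimensionLT_X₃_iff n
      (ModuleCat.projective_of_categoryTheory_projective (ModuleCat.of A (Fin m → A)))).1 hN

end ExactFunctor

theorem exists_hasProjectiveDimensionLT_of_lt_top {N : ModuleCat.{u} A}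
    (h : projectiveDimension N < ⊤) : ∃ n : ℕ, HasProjectiveDimensionLT N (n + 1) :=
  (projectiveDimension_ne_top_iff N).1 h.ne

end Modules

/-! ### Torsionless modules and weakly Gorenstein algebras -/

section Torsionless

variable {A : Type u} [Ring A]

theorem bidualMap_injective_iff {X : Type u} [AddCommGroup X] [Module A X] :
    Function.Injective (bidualMap A X) ↔ ∀ x : X, (∀ f : X →ₗ[A] A, f x = 0) → x = 0 := by
  rw [injective_iff_map_eq_zero]
  exact forall_congr' fun x => imp_congr_left LinearMap.ext_iff

/-- A torsionless module embeds into a free module, so its elements are separated by linear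
forms. -/
theorem IsTorsionless.eq_zero_of_forall {X : Type u} [AddCommGroup X] [Module A X]
    (hX : IsTorsionless A X) {x : X} (hx : ∀ f : X →ₗ[A] A, f x = 0) : x = 0 := by
  obtain ⟨P, f, hP, hf⟩ := hX
  obtain ⟨s, hs⟩ := Module.projective_def'.1 hP
  have h0 : s (f x) = 0 := by
    ext p
    exact hx (Finsupp.lapply p ∘ₗ s ∘ₗ f)
  apply hf
  rw [map_zero, ← LinearMap.id_apply (R := A) (f x), ← hs, LinearMap.comp_apply, h0, map_zero]

variable (A) in
/-- The ring `A` is the regular module over `Aᵐᵒᵖ`. -/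
def opRegularEquiv : Aᵐᵒᵖ ≃ₗ[Aᵐᵒᵖ] A where
  __ := MulOpposite.opAddEquiv.symm
  map_smul' _ _ := rfl

instance [IsNoetherianRing Aᵐᵒᵖ] : IsNoetherian Aᵐᵒᵖ A :=
  isNoetherian_of_linearEquiv (opRegularEquiv A)

instance Module.Finite.linearMap_op [IsNoetherianRing Aᵐᵒᵖ] (X : Type u) [AddCommGroup X]
    [Module A X] [Module.Finite A X] : Module.Finite Aᵐᵒᵖ (X →ₗ[A] A) := by
  obtain ⟨n, g, hg⟩ := Module.Finite.exists_fin' A X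
  let e : (X →ₗ[A] A) →ₗ[Aᵐᵒᵖ] (Fin n → A) :=
    { toFun := fun f i => f (g (Pi.single i 1))
      map_add' := fun _ _ => rfl
      map_smul' := fun _ _ => rfl }
  refine Module.Finite.of_injective e fun f f' h => ?_
  have h1 : f ∘ₗ g = f' ∘ₗ g := by
    ext i
    simpa using show f (g (Pi.single i 1)) = f' (g (Pi.single i 1)) from congrFun h i
  ext x
  obtain ⟨v, rfl⟩ := hg x
  exact LinearMap.congr_fun h1 v

/-- The dual of `A^n`, as a right module. -/
def dualPiEquiv (n : ℕ) : ((Fin n → A) →ₗ[A] A) ≃ₗ[Aᵐᵒᵖ] (Fin n → A) where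
  toFun f i := f (Pi.single i 1)
  map_add' _ _ := rfl
  map_smul' _ _ := rfl
  invFun c := Fintype.linearCombination A c
  left_inv f := by
    ext i
    simp [Fintype.linearCombination_apply, Pi.single_apply]
  right_inv c := by
    ext i
    simp [Fintype.linearCombination_apply, Pi.single_apply]

instance (n : ℕ) : Module.Projective Aᵐᵒᵖ ((Fin n → A) →ₗ[A] A) :=
  .of_equiv ((LinearEquiv.piCongrRight fun _ : Fin n => opRegularEquiv A).trans
    (dualPiEquiv n).symm)

/-- Every right linear form on the dual of `A^n` is the evaluation at a vector. -/
theorem exists_eval_dual_pi {n : ℕ} (ξ : ((Fin n → A) →ₗ[A] A) →ₗ[Aᵐᵒᵖ] A) :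
    ∃ v : Fin n → A, ∀ h, ξ h = h v := by
  refine ⟨fun i => ξ (LinearMap.proj i), fun h => ?_⟩
  have h1 : h = ∑ i, MulOpposite.op (h (Pi.single i 1)) • LinearMap.proj (φ := fun _ => A) i := by
    ext i
    simp [Pi.single_apply]
  conv_lhs => rw [h1]
  conv_rhs => rw [h1]
  simp [map_sum]

/-- A left approximation of a finitely generated module `X` by a free module. -/
theorem exists_leftApproximation [IsNoetherianRing Aᵐᵒᵖ] (X : Type u) [AddCommGroup X]
    [Module A X] [Module.Finite A X] :
    ∃ (n : ℕ) (ι : X →ₗ[A] (Fin n → A)),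
      ∀ f : X →ₗ[A] A, ∃ g : (Fin n → A) →ₗ[A] A, g ∘ₗ ι = f := by
  obtain ⟨n, p, hp⟩ := Module.Finite.exists_fin' Aᵐᵒᵖ (X →ₗ[A] A)
  refine ⟨n, LinearMap.pi fun i => p (Pi.single i 1), fun f => ?_⟩
  obtain ⟨c, rfl⟩ := hp f
  refine ⟨Fintype.linearCombination A fun i => (c i).unop, ?_⟩
  have h1 : c = ∑ i, c i • Pi.single i (1 : Aᵐᵒᵖ) := by
    ext i
    simp [Finset.sum_apply, Pi.single_apply]
  conv_rhs => rw [h1]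
  ext x
  simp [Fintype.linearCombination_apply, map_sum, LinearMap.sum_apply]

theorem IsSemiGorensteinProjective.ker [IsNoetherianRing A] {X F : Type u} [AddCommGroup X]
    [Module A X] [AddCommGroup F] [Module A F] [Module.Finite A F] [Module.Projective A F]
    (hX : IsSemiGorensteinProjective A (ModuleCat.of A X)) {g : F →ₗ[A] X}
    (hg : Function.Surjective g) :
    IsSemiGorensteinProjective A (ModuleCat.of A (LinearMap.ker g)) :=
  ⟨inferInstanceAs (Module.Finite A (LinearMap.ker g)),
    ExtVanishes.X₁ (shortExact_of_linearMap (LinearMap.ker g).injective_subtype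
      (LinearMap.exact_subtype_ker_map g) hg)
      (have := ModuleCat.projective_of_categoryTheory_projective (ModuleCat.of A F)
       ExtVanishes.of_projective (ModuleCat.of A F) _) hX.2⟩

/-- A torsionless semi-Gorenstein-projective module `X` embeds into some `A^n` so that all linear
forms on `X` extend to `A^n`; the cokernel is again semi-Gorenstein-projective. -/
theorem IsSemiGorensteinProjective.exists_embedding [IsNoetherianRing Aᵐᵒᵖ] {X : Type u}
    [AddCommGroup X] [Module A X] (hX : IsSemiGorensteinProjective A (ModuleCat.of A X))
    (h : Function.Injective (bidualMap A X)) :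
    ∃ (n : ℕ) (ι : X →ₗ[A] (Fin n → A)), Function.Injective ι ∧
      (∀ f : X →ₗ[A] A, ∃ g : (Fin n → A) →ₗ[A] A, g ∘ₗ ι = f) ∧
      IsSemiGorensteinProjective A (ModuleCat.of A ((Fin n → A) ⧸ LinearMap.range ι)) := by
  have hfin : Module.Finite A X := hX.1
  obtain ⟨n, ι, hι⟩ := exists_leftApproximation (A := A) X
  have hinj : Function.Injective ι := by
    rw [injective_iff_map_eq_zero]
    intro x hx
    refine bidualMap_injective_iff.1 h x fun f => ?_
    obtain ⟨g, rfl⟩ := hι f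
    rw [LinearMap.comp_apply, hx, map_zero]
  refine ⟨n, ι, hinj, hι, inferInstanceAs (Module.Finite A (_ ⧸ LinearMap.range ι)), ?_⟩
  have := ModuleCat.projective_of_categoryTheory_projective (ModuleCat.of A (Fin n → A))
  exact ExtVanishes.of_exact_right hinj (LinearMap.exact_map_mkQ_range ι)
    (Submodule.mkQ_surjective _) hX.2 (.of_projective _ _) hι

/-- Restriction of linear forms along `ι : X → F`, as a map of right modules. -/
def dualMap {X F : Type u} [AddCommGroup X] [Module A X] [AddCommGroup F] [Module A F]
    (ι : X →ₗ[A] F) : (F →ₗ[A] A) →ₗ[Aᵐᵒᵖ] (X →ₗ[A] A) where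
  toFun f := f ∘ₗ ι
  map_add' _ _ := rfl
  map_smul' _ _ := rfl

theorem dualMap_injective {X F : Type u} [AddCommGroup X] [Module A X] [AddCommGroup F]
    [Module A F] {g : F →ₗ[A] X} (hg : Function.Surjective g) :
    Function.Injective (dualMap g) := fun _ _ h => LinearMap.ext fun x => by
  obtain ⟨v, rfl⟩ := hg x
  exact LinearMap.congr_fun h v

theorem dualMap_exact {K X F : Type u} [AddCommGroup K] [Module A K] [AddCommGroup X]
    [Module A X] [AddCommGroup F] [Module A F] {f : K →ₗ[A] F} {g : F →ₗ[A] X}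
    (hfg : Function.Exact f g) (hg : Function.Surjective g) :
    Function.Exact (dualMap g) (dualMap f) := by
  intro φ
  constructor
  · intro h
    refine ⟨(LinearMap.ker g).liftQ φ (fun v hv => ?_) ∘ₗ
      (g.quotKerEquivOfSurjective hg).symm.toLinearMap, ?_⟩
    · obtain ⟨k, rfl⟩ := (hfg v).1 hv
      exact LinearMap.congr_fun h k
    · ext v
      have : (g.quotKerEquivOfSurjective hg).symm (g v) = (LinearMap.ker g).mkQ v := by
        rw [LinearEquiv.symm_apply_eq]
        rfl
      simp [dualMap, this]
  · rintro ⟨ψ, rfl⟩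
    ext k
    simp [dualMap, hfg.apply_apply_eq_zero]

/-- If all semi-Gorenstein-projective modules are torsionless, they are reflexive: a form `ξ` on
`X^*` gives a vector of `A^n` for an embedding of `X` into `A^n` as above, and this vector lies in
`X` because the cokernel is torsionless. -/
theorem bidualMap_bijective_of_torsionless [IsNoetherianRing Aᵐᵒᵖ]
    (h : ∀ X : ModuleCat.{u} A, IsSemiGorensteinProjective A X →
      Function.Injective (bidualMap A X))
    {X : Type u} [AddCommGroup X] [Module A X]
    (hX : IsSemiGorensteinProjective A (ModuleCat.of A X)) :
    Function.Bijective (bidualMap A X) := by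
  refine ⟨h (ModuleCat.of A X) hX, fun ξ => ?_⟩
  obtain ⟨n, ι, -, hext, hcok⟩ := hX.exists_embedding (h (ModuleCat.of A X) hX)
  obtain ⟨v, hv⟩ := exists_eval_dual_pi (ξ ∘ₗ dualMap ι)
  have hvι : v ∈ LinearMap.range ι := by
    rw [← Submodule.Quotient.mk_eq_zero]
    refine bidualMap_injective_iff.1 (h _ hcok) _ fun f => ?_
    have h1 := hv (f ∘ₗ (LinearMap.range ι).mkQ)
    have h2 : dualMap ι (f ∘ₗ (LinearMap.range ι).mkQ) = 0 := by
      ext x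
      have : (LinearMap.range ι).mkQ (ι x) = 0 := by simp
      simp only [dualMap, LinearMap.coe_mk, AddHom.coe_mk, LinearMap.comp_apply, this, map_zero,
        LinearMap.zero_apply]
    rw [LinearMap.comp_apply, h2, map_zero] at h1
    exact h1.symm
  obtain ⟨x, rfl⟩ := hvι
  refine ⟨x, LinearMap.ext fun f => ?_⟩
  obtain ⟨g, rfl⟩ := hext f
  exact (hv g).symm

/-- A ring is weakly Gorenstein as soon as all its semi-Gorenstein-projective modules are
torsionless. -/
theorem isWeaklyGorenstein_of_torsionless [IsNoetherianRing Aᵐᵒᵖ]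
    (h : ∀ X : ModuleCat.{u} A, IsSemiGorensteinProjective A X →
      Function.Injective (bidualMap A X)) : IsWeaklyGorenstein A := by
  intro X hX
  have hfin : Module.Finite A X := hX.1
  refine ⟨hX, ⟨Module.Finite.linearMap_op X, ?_⟩, bidualMap_bijective_of_torsionless h hX⟩
  -- The duals of embeddings of `X` with semi-Gorenstein-projective cokernel `X'` are projective
  -- presentations of `X^*` with kernel `X'^*`.
  refine ExtVanishes.of_presentations (fun Q : ModuleCat.{u} Aᵐᵒᵖ =>
    ∃ X : ModuleCat.{u} A, IsSemiGorensteinProjective A X ∧ Q = ModuleCat.of Aᵐᵒᵖ (X →ₗ[A] A))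
    ?_ ⟨X, hX, rfl⟩
  rintro _ ⟨X, hX, rfl⟩
  obtain ⟨n, ι, -, hext, hcok⟩ := hX.exists_embedding (h X hX)
  refine ⟨_, shortExact_of_linearMap (dualMap_injective (Submodule.mkQ_surjective _))
    (dualMap_exact (LinearMap.exact_map_mkQ_range ι) (Submodule.mkQ_surjective _)) hext, rfl,
    ModuleCat.projective_of_categoryTheory_projective _, ⟨_, hcok, rfl⟩, fun ξ => ?_⟩
  obtain ⟨x', hx'⟩ := (bidualMap_bijective_of_torsionless h hcok).2 ξ.hom
  obtain ⟨v, rfl⟩ := Submodule.mkQ_surjective _ x'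
  exact ⟨ModuleCat.ofHom (bidualMap A (Fin n → A) v),
    ModuleCat.hom_ext (LinearMap.ext fun f => LinearMap.congr_fun hx' f)⟩

end Torsionless

section InjectiveDimension

variable {A : Type u} [Ring A]

/-- A presentation of a semi-Gorenstein-projective module dualizes to a short exact sequence. -/
theorem IsSemiGorensteinProjective.shortExact_dual {X F : Type u} [AddCommGroup X]
    [Module A X] [AddCommGroup F] [Module A F]
    (hX : IsSemiGorensteinProjective A (ModuleCat.of A X)) {g : F →ₗ[A] X}
    (hg : Function.Surjective g) :
    (ModuleCat.shortComplexOfCompEqZero _ _ (dualMap_exact (LinearMap.exact_subtype_ker_map g)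
      hg).linearMap_comp_eq_zero).ShortExact :=
  shortExact_of_linearMap (dualMap_injective hg)
    (dualMap_exact (LinearMap.exact_subtype_ker_map g) hg) fun φ =>
    ExtVanishes.exists_linearMap_extension (LinearMap.ker g).injective_subtype
      (LinearMap.exact_subtype_ker_map g) hg hX.2 φ

/-- If the right regular module has finite injective dimension, then `X^*` lies in `⊥(A_A)` for
each semi-Gorenstein-projective `X`: by the dual of a presentation `0 → K → F → X → 0`,
`Ext^i(X^*, A) = Ext^{i+1}(K^*, A)`. -/
theorem IsSemiGorensteinProjective.extVanishes_dual [IsNoetherianRing A]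
    (h : injectiveDimension (ModuleCat.of Aᵐᵒᵖ A) < ⊤) {X : Type u} [AddCommGroup X] [Module A X]
    (hX : IsSemiGorensteinProjective A (ModuleCat.of A X)) :
    ExtVanishes (ModuleCat.of Aᵐᵒᵖ (X →ₗ[A] A)) (ModuleCat.of Aᵐᵒᵖ A) := by
  obtain ⟨d, hd⟩ := (injectiveDimension_ne_top_iff _).1 h.ne
  suffices ∀ (k : ℕ) (X : ModuleCat.{u} A), IsSemiGorensteinProjective A X →
      ∀ i, 1 ≤ i → d + 1 ≤ i + k → Subsingleton
        (Abelian.Ext (ModuleCat.of Aᵐᵒᵖ (X →ₗ[A] A)) (ModuleCat.of Aᵐᵒᵖ A) i) from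
    fun i hi => this d (ModuleCat.of A X) hX i hi (by lia)
  intro k
  induction k with
  | zero =>
    intro X hX i hi hik
    exact HasInjectiveDimensionLT.subsingleton _ (d + 1) i hik _
  | succ k ih =>
    intro X hX i hi hik
    have hfin : Module.Finite A X := hX.1
    obtain ⟨n, g, hg, hK⟩ := exists_finite_free_presentation (A := A) X
    refine Ext.subsingleton_X₁ (hX.shortExact_dual hg) ?_
      (ih _ (hX.ker hg) (i + 1) (by lia) (by lia))
    have := ModuleCat.projective_of_categoryTheory_projective
      (ModuleCat.of Aᵐᵒᵖ ((Fin n → A) →ₗ[A] A))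
    exact ExtVanishes.of_projective _ _ i hi

/-- If the right regular module has finite injective dimension, semi-Gorenstein-projective left
modules are torsionless. For a presentation `F₁ → F₀ → X → 0`, an element of `F₀` killed by `X^*`
is a form on `K^*`, where `K` is the first syzygy; it extends to `F₁^*` because `Ext¹` of the dual
of the second syzygy vanishes. -/
theorem isWeaklyGorenstein_of_injectiveDimension_op_lt_top [IsNoetherianRing A]
    [IsNoetherianRing Aᵐᵒᵖ] (h : injectiveDimension (ModuleCat.of Aᵐᵒᵖ A) < ⊤) :
    IsWeaklyGorenstein A := by
  refine isWeaklyGorenstein_of_torsionless fun X hX => bidualMap_injective_iff.2 fun x hx => ?_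
  have hfin : Module.Finite A X := hX.1
  obtain ⟨n, g, hg, hK⟩ := exists_finite_free_presentation (A := A) X
  obtain ⟨m, g', hg', hK'⟩ := exists_finite_free_presentation (A := A) (LinearMap.ker g)
  obtain ⟨p, rfl⟩ := hg x
  have hsyz := hX.ker hg
  have hex := hX.shortExact_dual hg
  -- evaluation at `p`, as a form on the dual of the first syzygy
  let res : ((Fin n → A) →ₗ[A] A) →ₗ[Aᵐᵒᵖ] (LinearMap.ker g →ₗ[A] A) :=
    dualMap (LinearMap.ker g).subtype
  have hres : Function.Surjective res := hex.moduleCat_surjective_g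
  obtain ⟨ξ, hξ⟩ : ∃ ξ : (LinearMap.ker g →ₗ[A] A) →ₗ[Aᵐᵒᵖ] A,
      ∀ f : (Fin n → A) →ₗ[A] A, ξ (res f) = f p := by
    refine ⟨(LinearMap.ker res).liftQ (bidualMap A _ p) (fun f hf => ?_) ∘ₗ
      (res.quotKerEquivOfSurjective hres).symm.toLinearMap, fun f => ?_⟩
    · obtain ⟨ψ, rfl⟩ :=
        (dualMap_exact (LinearMap.exact_subtype_ker_map g) hg f).1 hf
      exact hx ψ
    · have : (res.quotKerEquivOfSurjective hres).symm (res f) = (LinearMap.ker res).mkQ f := by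
        rw [LinearEquiv.symm_apply_eq]
        rfl
      simp [this, bidualMap]
  obtain ⟨ξ', hξ'⟩ := ExtVanishes.exists_extension (hsyz.shortExact_dual hg')
    ((hsyz.ker hg').extVanishes_dual h) (ModuleCat.ofHom ξ)
  obtain ⟨q, hq⟩ := exists_eval_dual_pi ξ'.hom
  have hpq : p = (g' q : Fin n → A) := by
    ext i
    have h1 := hξ (LinearMap.proj i)
    have h2 := LinearMap.congr_fun (congrArg ModuleCat.Hom.hom hξ') (res (LinearMap.proj i))
    exact (h1.symm.trans h2.symm).trans (hq _)
  rw [hpq]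
  exact (g' q).2

end InjectiveDimension

/-! ### The duality of an Artin algebra -/

section Cogenerator

/-- The injective envelope of `R / rad R` is a cogenerator: a nonzero cyclic module has a simple
quotient, which embeds into the semisimple module `R / rad R`. -/
theorem exists_topEnvelope_ne_zero (R : Type u) [CommRing R] [IsArtinianRing R] {N : Type u}
    [AddCommGroup N] [Module R N] {x : N} (hx : x ≠ 0) :
    ∃ h : N →ₗ[R] topEnvelope R, h x ≠ 0 := by
  have hE := isInjectiveEnvelope_topEnvelopeMap R
  have := hE.injective_module
  have hne : Ideal.torsionOf R N x ≠ ⊤ := by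
    intro h
    apply hx
    have : (1 : R) ∈ Ideal.torsionOf R N x := h ▸ Submodule.mem_top
    simpa [Ideal.mem_torsionOf_iff] using this
  obtain ⟨I, hI, hle⟩ := Ideal.exists_le_maximal _ hne
  have hJ : Ring.jacobson R ≤ I := by
    rw [Ring.jacobson_eq_sInf_isMaximal]
    exact sInf_le hI
  have hss : IsSemisimpleModule R (R ⧸ Ring.jacobson R) :=
    (LinearMap.isSemisimpleModule_iff_of_bijective
      (σ := Ideal.Quotient.mk (Ring.jacobson R))
      (l := { toFun := id, map_add' := fun _ _ => rfl, map_smul' := fun r y => by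
                induction y using Submodule.Quotient.induction_on
                rfl })
      Function.bijective_id).2 (IsSemiprimaryRing.isSemisimpleRing (R := R))
  -- the surjection `R / rad R → R / I` splits
  obtain ⟨s, hs⟩ := IsSemisimpleModule.lifting_property
    (Submodule.factor hJ) (Submodule.factor_surjective hJ) (LinearMap.id (R := R) (M := R ⧸ I))
  let q : (R ⧸ Ideal.torsionOf R N x) →ₗ[R] topEnvelope R :=
    topEnvelopeMap R ∘ₗ s ∘ₗ Submodule.factor hle
  obtain ⟨h, hh⟩ := Module.Injective.extension_property R (topEnvelope R) _ _
    (Submodule.subtype (Submodule.span R {x})) (Submodule.injective_subtype _)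
    (q ∘ₗ (Ideal.quotTorsionOfEquivSpanSingleton R N x).symm.toLinearMap)
  refine ⟨h, fun h0 => ?_⟩
  let e := Ideal.quotTorsionOfEquivSpanSingleton R N x
  have hx' : ((e (Submodule.Quotient.mk 1) : Submodule.span R {x}) : N) = x := by
    rw [Ideal.quotTorsionOfEquivSpanSingleton_apply_mk, one_smul]
  have h1 : h (e (Submodule.Quotient.mk 1) : Submodule.span R {x}) =
      q (e.symm (e (Submodule.Quotient.mk 1))) :=
    LinearMap.congr_fun hh (e (Submodule.Quotient.mk 1))
  rw [hx', h0, LinearEquiv.symm_apply_apply] at h1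
  have h2 : topEnvelopeMap R (s (Submodule.Quotient.mk (1 : R))) = 0 := h1.symm
  have h3 : s (Submodule.Quotient.mk (1 : R)) = 0 := hE.injective_map (h2.trans (map_zero _).symm)
  have h4 := LinearMap.congr_fun hs (Submodule.Quotient.mk (1 : R))
  rw [LinearMap.comp_apply, h3, map_zero, LinearMap.id_apply, eq_comm,
    Submodule.Quotient.mk_eq_zero] at h4
  exact hI.ne_top ((Ideal.eq_top_iff_one I).2 h4)

end Cogenerator

section ArtinDual

variable {R B : Type u} [CommRing R] [Ring B] [Algebra R B]

/-- The elements of `D(M)` as linear maps. -/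
noncomputable def ArtinDual.toLin {M : Type u} [AddCommGroup M] [Module R M] :
    ArtinDual R M ≃+ (M →ₗ[R] topEnvelope R) := AddEquiv.refl _

section

variable {M : Type u} [AddCommGroup M] [Module R M] [Module Bᵐᵒᵖ M] [IsScalarTower R Bᵐᵒᵖ M]

@[simp]
theorem ArtinDual.toLin_smul (b : B) (f : ArtinDual R M) (m : M) :
    ArtinDual.toLin (b • f) m = ArtinDual.toLin f (MulOpposite.op b • m) := rfl

theorem ArtinDual.ext {f g : ArtinDual R M} (h : ∀ m, toLin f m = toLin g m) : f = g :=
  LinearMap.ext h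

/-- `D` on morphisms. -/
noncomputable def ArtinDual.map {K : Type u} [AddCommGroup K] [Module R K] [Module Bᵐᵒᵖ K]
    [IsScalarTower R Bᵐᵒᵖ K] (f : K →ₗ[Bᵐᵒᵖ] M) : ArtinDual R M →ₗ[B] ArtinDual R K where
  toFun φ := toLin.symm (toLin φ ∘ₗ f.restrictScalars R)
  map_add' _ _ := rfl
  map_smul' b φ := ArtinDual.ext fun k => by
    exact congrArg (toLin φ) (map_smul f (MulOpposite.op b) k).symm

theorem ArtinDual.toLin_map {K : Type u} [AddCommGroup K] [Module R K] [Module Bᵐᵒᵖ K]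
    [IsScalarTower R Bᵐᵒᵖ K] (f : K →ₗ[Bᵐᵒᵖ] M) (φ : ArtinDual R M) (k : K) :
    toLin (map (B := B) f φ) k = toLin φ (f k) := rfl

/-- The dual of a projective right module is an injective left module. -/
theorem ArtinDual.injective_of_projective [Module.Projective Bᵐᵒᵖ M] :
    Module.Injective B (ArtinDual R M) := by
  refine ⟨fun X Y _ _ _ _ f hf g => ?_⟩
  let : Module R X := Module.compHom X (algebraMap R B)
  let : Module R Y := Module.compHom Y (algebraMap R B)
  have hRX (r : R) (x : X) : r • x = algebraMap R B r • x := rfl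
  have hRY (r : R) (y : Y) : r • y = algebraMap R B r • y := rfl
  have hRM (r : R) (m : M) : MulOpposite.op (algebraMap R B r) • m = r • m := by
    rw [← MulOpposite.algebraMap_apply, algebraMap_smul]
  have := (isInjectiveEnvelope_topEnvelopeMap R).injective_module
  -- for `p ∈ M`, the `R`-linear map `x ↦ g(x)(p)` extends to `Y`
  have hγ (p : M) : ∃ γ : Y →ₗ[R] topEnvelope R, ∀ x, γ (f x) = toLin (g x) p := by
    obtain ⟨γ, hγ⟩ := Module.Injective.extension_property R (topEnvelope R) X Y
      { toFun := f, map_add' := map_add f, map_smul' := fun r x => map_smul f _ x } hf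
      { toFun := fun x => toLin (g x) p
        map_add' := fun x x' => by rw [map_add, map_add, LinearMap.add_apply]
        map_smul' := fun r x => by
          rw [hRX, map_smul, toLin_smul, hRM, map_smul, RingHom.id_apply] }
    exact ⟨γ, fun x => LinearMap.congr_fun hγ x⟩
  choose γ hγ using hγ
  obtain ⟨s, hs⟩ := Module.projective_def'.1 ‹Module.Projective Bᵐᵒᵖ M›
  let ℓ (y : Y) : (M →₀ Bᵐᵒᵖ) →ₗ[R] topEnvelope R :=
    Finsupp.lsum R fun p => γ p ∘ₗ
      { toFun := fun c => c.unop • y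
        map_add' := fun c c' => by rw [MulOpposite.unop_add, add_smul]
        map_smul' := fun r c => by
          rw [hRY, RingHom.id_apply, smul_smul, MulOpposite.unop_smul, Algebra.smul_def] }
  have hℓ (y : Y) (p : M) (c : Bᵐᵒᵖ) : ℓ y (Finsupp.single p c) = γ p (c.unop • y) := by
    simp [ℓ]
  refine ⟨⟨⟨fun y => toLin.symm (ℓ y ∘ₗ s.restrictScalars R), fun y y' => ?_⟩, fun b y => ?_⟩,
    fun x => ?_⟩
  · have h1 : ℓ (y + y') = ℓ y + ℓ y' := by
      refine Finsupp.lhom_ext fun p c => ?_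
      rw [LinearMap.add_apply, hℓ, hℓ, hℓ, smul_add, map_add]
    refine ArtinDual.ext fun m => ?_
    simp [h1]
  · refine ArtinDual.ext fun m => ?_
    have h1 (v : M →₀ Bᵐᵒᵖ) : ℓ (b • y) v = ℓ y (MulOpposite.op b • v) := by
      induction v using Finsupp.induction_linear with
      | zero => simp
      | add v w hv hw => rw [map_add, hv, hw, smul_add, map_add]
      | single p c => rw [hℓ, Finsupp.smul_single, hℓ, smul_smul]; rfl
    simp [h1]
  · refine ArtinDual.ext fun m => ?_
    have h1 (v : M →₀ Bᵐᵒᵖ) :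
        ℓ (f x) v = toLin (g x) (Finsupp.linearCombination Bᵐᵒᵖ id v) := by
      induction v using Finsupp.induction_linear with
      | zero => simp
      | add v w hv hw => rw [map_add, hv, hw, map_add, map_add]
      | single p c =>
        rw [hℓ, ← map_smul, hγ, map_smul, toLin_smul, Finsupp.linearCombination_single]
        rfl
    have h2 := h1 (s m)
    rw [← LinearMap.comp_apply, hs, LinearMap.id_apply] at h2
    exact h2

end

/-- `D` turns short exact sequences of right modules into short exact sequences of left modules. -/
theorem ArtinDual.shortExact {K F M : Type u} [AddCommGroup K] [Module R K] [Module Bᵐᵒᵖ K]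
    [IsScalarTower R Bᵐᵒᵖ K] [AddCommGroup F] [Module R F] [Module Bᵐᵒᵖ F]
    [IsScalarTower R Bᵐᵒᵖ F] [AddCommGroup M] [Module R M] [Module Bᵐᵒᵖ M]
    [IsScalarTower R Bᵐᵒᵖ M] {f : K →ₗ[Bᵐᵒᵖ] F} {g : F →ₗ[Bᵐᵒᵖ] M}
    (hf : Function.Injective f) (hfg : Function.Exact f g) (hg : Function.Surjective g) :
    Function.Injective (ArtinDual.map (R := R) (B := B) g) ∧
    Function.Exact (ArtinDual.map (R := R) (B := B) g) (ArtinDual.map (R := R) (B := B) f) ∧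
    Function.Surjective (ArtinDual.map (R := R) (B := B) f) := by
  refine ⟨fun φ ψ h => ArtinDual.ext fun m => ?_, fun φ => ⟨fun h => ?_, ?_⟩, fun φ => ?_⟩
  · obtain ⟨v, rfl⟩ := hg m
    exact LinearMap.congr_fun h v
  · let g' : F →ₗ[R] M := g.restrictScalars R
    have hg' : Function.Surjective g' := hg
    refine ⟨toLin.symm ((LinearMap.ker g').liftQ (toLin φ) (fun v hv => ?_) ∘ₗ
      (g'.quotKerEquivOfSurjective hg').symm.toLinearMap), ArtinDual.ext fun v => ?_⟩
    · obtain ⟨k, rfl⟩ := (hfg v).1 hv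
      exact LinearMap.congr_fun h k
    · have h1 : (g'.quotKerEquivOfSurjective hg').symm (g v) = (LinearMap.ker g').mkQ v := by
        rw [LinearEquiv.symm_apply_eq]
        rfl
      rw [toLin_map]
      simp [h1]
  · rintro ⟨ψ, rfl⟩
    refine ArtinDual.ext fun k => ?_
    rw [toLin_map, toLin_map, hfg.apply_apply_eq_zero, map_zero]
    rfl
  · have := (isInjectiveEnvelope_topEnvelopeMap R).injective_module
    obtain ⟨ψ, hψ⟩ := Module.Injective.extension_property R (topEnvelope R) K F
      (f.restrictScalars R) hf (toLin φ)
    exact ⟨toLin.symm ψ, hψ⟩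

theorem ArtinDual.mem_rightPerp_of_projective (M : Type u) [AddCommGroup M] [Module R M]
    [Module Bᵐᵒᵖ M] [IsScalarTower R Bᵐᵒᵖ M] [Module.Projective Bᵐᵒᵖ M]
    (𝒮 : Set (ModuleCat.{u} B)) : ModuleCat.of B (ArtinDual R M) ∈ rightPerp B 𝒮 := by
  intro X _
  have := ArtinDual.injective_of_projective (R := R) (B := B) (M := M)
  have : Injective (ModuleCat.of B (ArtinDual R M)) :=
    Module.injective_object_of_injective_module B (ArtinDual R M)
  exact ExtVanishes.of_injective _ _

/-- Over a weakly Gorenstein algebra, `D(M)` lies in `(⊥B)^⊥` for each right module `M` of finite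
projective dimension: semi-Gorenstein-projective modules are arbitrarily high syzygies of
semi-Gorenstein-projective modules, and `D(M)` has finite injective dimension. -/
theorem ArtinDual.mem_rightPerp_of_isWeaklyGorenstein [IsNoetherianRing Bᵐᵒᵖ]
    (hB : IsWeaklyGorenstein B) (n : ℕ) (M : Type u) [AddCommGroup M] [Module R M]
    [Module Bᵐᵒᵖ M] [IsScalarTower R Bᵐᵒᵖ M]
    (hM : HasProjectiveDimensionLT (ModuleCat.of Bᵐᵒᵖ M) (n + 1)) :
    ModuleCat.of B (ArtinDual R M) ∈ rightPerp B (leftPerp B (ModuleCat.of B B)) := by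
  induction n generalizing M with
  | zero =>
    have : Module.Projective Bᵐᵒᵖ M := (IsProjective.iff_projective M).2
      (projective_iff_hasProjectiveDimensionLT_one.2 hM)
    exact mem_rightPerp_of_projective M _
  | succ n ih =>
    let g : (M →₀ Bᵐᵒᵖ) →ₗ[Bᵐᵒᵖ] M := Finsupp.linearCombination Bᵐᵒᵖ id
    have hg : Function.Surjective g := Finsupp.linearCombination_id_surjective Bᵐᵒᵖ M
    have hS := shortExact_of_linearMap (A := Bᵐᵒᵖ) (K := LinearMap.ker g) (F := M →₀ Bᵐᵒᵖ)
      (X := M) (f := (LinearMap.ker g).subtype) (g := g) (LinearMap.ker g).injective_subtype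
      (LinearMap.exact_subtype_ker_map g) hg
    have hK := ih (LinearMap.ker g) ((hS.hasProjectiveDimensionLT_X₃_iff n
      (ModuleCat.projective_of_categoryTheory_projective (ModuleCat.of _ (M →₀ Bᵐᵒᵖ)))).1 hM)
    obtain ⟨h1, h2, h3⟩ := ArtinDual.shortExact (R := R) (B := B) (K := LinearMap.ker g)
      (F := M →₀ Bᵐᵒᵖ) (M := M) (f := (LinearMap.ker g).subtype) (g := g)
      (LinearMap.ker g).injective_subtype (LinearMap.exact_subtype_ker_map g) hg
    have hD := shortExact_of_linearMap h1 h2 h3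
    have hF := mem_rightPerp_of_projective (R := R) (B := B) (M →₀ Bᵐᵒᵖ)
      (leftPerp B (ModuleCat.of B B))
    have key (X : ModuleCat.{u} B) (hX : IsSemiGorensteinProjective B X) (i : ℕ) (hi : 1 ≤ i) :
        Subsingleton (Abelian.Ext X (ModuleCat.of B (ArtinDual R M)) (i + 1)) :=
      Ext.subsingleton_right_X₁ hD (hF X hX (i + 1) (by lia)) (hK X hX i hi)
    rintro X hX (_ | _ | i) hi
    · simp at hi
    · obtain ⟨m, ι, hι, -, hcok⟩ := IsSemiGorensteinProjective.exists_embedding hX (hB X hX).2.2.1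
      have := ModuleCat.projective_of_categoryTheory_projective (ModuleCat.of B (Fin m → B))
      exact Ext.subsingleton_X₁ (shortExact_of_linearMap hι (LinearMap.exact_map_mkQ_range ι)
        (Submodule.mkQ_surjective _)) (ExtVanishes.of_projective (ModuleCat.of B (Fin m → B)) _ 1
          le_rfl) (key _ hcok 1 le_rfl)
    · exact key X hX (i + 1) (by lia)

end ArtinDual

/-! ### Tensor products with a bimodule -/

namespace BimoduleTensor

section

variable {A M B : Type u} [Ring A] [Ring B] [AddCommGroup M] [Module A M] [Module Bᵐᵒᵖ M]
variable {Y : Type u} [AddCommGroup Y] [Module B Y]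

variable (A B) in
/-- The pure tensor `m ⊗ y` in `M ⊗_B Y`. -/
def tmul (m : M) (y : Y) : BimoduleTensor A M B Y :=
  (balancedRelations A M B Y).mkQ (m ⊗ₜ[ℤ] y)

theorem add_tmul (m m' : M) (y : Y) :
    tmul A B (m + m') y = tmul A B m y + tmul A B m' y := by
  simp [tmul, TensorProduct.add_tmul]

theorem tmul_add (m : M) (y y' : Y) :
    tmul A B m (y + y') = tmul A B m y + tmul A B m y' := by
  simp [tmul, TensorProduct.tmul_add]

theorem smul_tmul (a : A) (m : M) (y : Y) : a • tmul A B m y = tmul A B (a • m) y := rfl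

theorem op_smul_tmul (m : M) (b : B) (y : Y) :
    tmul A B (MulOpposite.op b • m) y = tmul A B m (b • y) := by
  rw [tmul, tmul, Submodule.mkQ_apply, Submodule.mkQ_apply, Submodule.Quotient.eq]
  exact Submodule.subset_span ⟨m, b, y, rfl⟩

@[simp]
theorem zero_tmul (y : Y) : tmul A B (0 : M) y = 0 := by
  simp [tmul]

@[simp]
theorem tmul_zero (m : M) : tmul A B m (0 : Y) = 0 := by
  simp [tmul]

@[elab_as_elim]
theorem induction_on {p : BimoduleTensor A M B Y → Prop} (t : BimoduleTensor A M B Y)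
    (zero : p 0) (tmul : ∀ m y, p (tmul A B m y)) (add : ∀ s t, p s → p t → p (s + t)) : p t := by
  obtain ⟨t, rfl⟩ := Submodule.mkQ_surjective _ t
  induction t using TensorProduct.induction_on with
  | zero => simpa using zero
  | tmul m y => exact tmul m y
  | add s t hs ht => rw [map_add]; exact add _ _ hs ht

/-- The linear map on `M ⊗_B Y` given by a balanced pairing. -/
def lift {X : Type u} [AddCommGroup X] [Module A X] (f : M →ₗ[A] Y →ₗ[ℤ] X)
    (hf : ∀ (m : M) (b : B) (y : Y), f (MulOpposite.op b • m) y = f m (b • y)) :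
    BimoduleTensor A M B Y →ₗ[A] X :=
  (balancedRelations A M B Y).liftQ (TensorProduct.AlgebraTensorModule.lift f) <| by
    rw [balancedRelations, Submodule.span_le]
    rintro _ ⟨m, b, y, rfl⟩
    rw [SetLike.mem_coe, LinearMap.mem_ker, map_sub, sub_eq_zero]
    exact hf m b y

theorem hom_ext {X : Type u} [AddCommGroup X] [Module A X] {f g : BimoduleTensor A M B Y →ₗ[A] X}
    (h : ∀ m y, f (tmul A B m y) = g (tmul A B m y)) : f = g := by
  refine LinearMap.ext fun t => ?_
  induction t using induction_on with
  | zero => rw [map_zero, map_zero]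
  | tmul m y => exact h m y
  | add s t hs ht => rw [map_add, map_add, hs, ht]

variable (A M) in
/-- The pairing `M × Y → M ⊗_B Y`. -/
def mk : M →ₗ[A] Y →ₗ[ℤ] BimoduleTensor A M B Y where
  toFun m := AddMonoidHom.toIntLinearMap ⟨⟨tmul A B m, tmul_zero m⟩, tmul_add m⟩
  map_add' m m' := LinearMap.ext fun y => add_tmul m m' y
  map_smul' _ _ := rfl

variable (A M) in
/-- The map `M ⊗ g`. -/
def map {Y' : Type u} [AddCommGroup Y'] [Module B Y'] (g : Y →ₗ[B] Y') :
    BimoduleTensor A M B Y →ₗ[A] BimoduleTensor A M B Y' :=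
  lift ⟨⟨fun m => mk A M m ∘ₗ g.toAddMonoidHom.toIntLinearMap,
      fun m m' => LinearMap.ext fun y => add_tmul m m' (g y)⟩, fun _ _ => rfl⟩
    fun m b y => (op_smul_tmul m b (g y)).trans (congrArg (tmul A B m) (map_smul g b y).symm)

theorem map_tmul {Y' : Type u} [AddCommGroup Y'] [Module B Y'] (g : Y →ₗ[B] Y') (m : M) (y : Y) :
    map A M g (tmul A B m y) = tmul A B m (g y) := rfl

end

section Contract

variable {A M B : Type u} [Ring A] [Ring B] [AddCommGroup M] [Module A M] [Module Bᵐᵒᵖ M]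
  [SMulCommClass A Bᵐᵒᵖ M]
variable {Y : Type u} [AddCommGroup Y] [Module B Y]

variable (A M) in
/-- The map `M ⊗_B Y → M ⊗_B B = M`, `m ⊗ y ↦ m g(y)`, of a linear form `g` on `Y`. -/
def contract (g : Y →ₗ[B] B) : BimoduleTensor A M B Y →ₗ[A] M :=
  lift
    { toFun := fun m => AddMonoidHom.toIntLinearMap
        { toFun := fun y => MulOpposite.op (g y) • m
          map_zero' := by rw [map_zero, MulOpposite.op_zero, zero_smul]
          map_add' := fun y y' => by rw [map_add, MulOpposite.op_add, add_smul] }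
      map_add' := fun m m' => LinearMap.ext fun y => smul_add (MulOpposite.op (g y)) m m'
      map_smul' := fun a m => LinearMap.ext fun y => (smul_comm a (MulOpposite.op (g y)) m).symm }
    fun m b y => by
      change MulOpposite.op (g y) • MulOpposite.op b • m = MulOpposite.op (g (b • y)) • m
      rw [smul_smul, ← MulOpposite.op_mul, map_smul, smul_eq_mul]

theorem contract_tmul (g : Y →ₗ[B] B) (m : M) (y : Y) :
    contract A M g (tmul A B m y) = MulOpposite.op (g y) • m := rfl

theorem contract_map {Y' : Type u} [AddCommGroup Y'] [Module B Y'] (g : Y →ₗ[B] Y')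
    (h : Y' →ₗ[B] B) (t : BimoduleTensor A M B Y) :
    contract A M h (map A M g t) = contract A M (h ∘ₗ g) t :=
  LinearMap.congr_fun (f := contract A M h ∘ₗ map A M g) (g := contract A M (h ∘ₗ g))
    (hom_ext fun _ _ => rfl) t

variable {R : Type u} [CommRing R] [IsArtinianRing R] [Algebra R A] [Algebra R B] [Module R M]
  [IsScalarTower R A M] [IsScalarTower R Bᵐᵒᵖ M]

variable (R) in
/-- If the `B`-linear maps `Y → D(M)` extend along `ι : Y → B^n`, then `M ⊗ ι` is injective, by
the adjunction `Hom_B(Y, D(M)) = D(M ⊗_B Y)` and since `D` is faithful. The injectivity is stated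
in terms of the components `M ⊗_B Y → M` of `M ⊗ ι`. -/
theorem eq_zero_of_contract_eq_zero {n : ℕ} (ι : Y →ₗ[B] (Fin n → B))
    (hι : ∀ β : Y →ₗ[B] ArtinDual R M, ∃ γ : (Fin n → B) →ₗ[B] ArtinDual R M, γ ∘ₗ ι = β)
    {t : BimoduleTensor A M B Y} (ht : ∀ j, contract A M (LinearMap.proj j ∘ₗ ι) t = 0) :
    t = 0 := by
  by_contra hne
  have hR (r : R) (m : M) (y : Y) : tmul A B (r • m) y = r • tmul A B m y := rfl
  obtain ⟨h, hh⟩ := exists_topEnvelope_ne_zero R hne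
  let β : Y →ₗ[B] ArtinDual R M :=
    { toFun := fun y => ArtinDual.toLin.symm
        { toFun := fun m => h (tmul A B m y)
          map_add' := fun m m' => by rw [add_tmul, map_add]
          map_smul' := fun r m => by rw [hR, map_smul, RingHom.id_apply] }
      map_add' := fun y y' => ArtinDual.ext fun m =>
        (congrArg h (tmul_add m y y')).trans (map_add h _ _)
      map_smul' := fun b y => ArtinDual.ext fun m => congrArg h (op_smul_tmul m b y).symm }
  obtain ⟨γ, hγ⟩ := hι β
  have key (s : BimoduleTensor A M B Y) :
      h s = ∑ j, ArtinDual.toLin (γ (Pi.single j 1)) (contract A M (LinearMap.proj j ∘ₗ ι) s) := by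
    induction s using induction_on with
    | zero => simp
    | add s t hs ht => simp only [map_add, hs, ht, Finset.sum_add_distrib]
    | tmul m y =>
      have h1 : h (tmul A B m y) = ArtinDual.toLin (β y) m := rfl
      have h2 : ι y = ∑ j, ι y j • Pi.single j (1 : B) := by
        ext j
        simp [Finset.sum_apply, Pi.single_apply]
      rw [h1, ← hγ, LinearMap.comp_apply, h2, map_sum, map_sum, LinearMap.sum_apply]
      refine Finset.sum_congr rfl fun j _ => ?_
      rw [map_smul, ArtinDual.toLin_smul, contract_tmul]
      rfl
  exact hh (by rw [key]; exact Finset.sum_eq_zero fun j _ => by rw [ht j, map_zero])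

end Contract

end BimoduleTensor

/-! ### Modules over the triangular matrix ring -/

namespace TriMat

section Ring

variable (A M B : Type u) [Ring A] [Ring B] [AddCommGroup M] [Module A M] [Module Bᵐᵒᵖ M]
  [SMulCommClass A Bᵐᵒᵖ M]

/-- The projection `Λ → A`. -/
def toTop : TriMat A M B →+* A where
  toFun := a
  map_one' := rfl
  map_mul' _ _ := rfl
  map_zero' := rfl
  map_add' _ _ := rfl

/-- The projection `Λ → B`. -/
def toBot : TriMat A M B →+* B where
  toFun := b
  map_one' := rfl
  map_mul' _ _ := rfl
  map_zero' := rfl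
  map_add' _ _ := rfl

variable (R : Type u) [CommRing R] [Algebra R A] [Algebra R B] [Module R M]
  [IsScalarTower R A M] [IsScalarTower R Bᵐᵒᵖ M]

/-- The diagonal embedding of `R`, which is central because `R` acts centrally on `M`. -/
instance : Algebra R (TriMat A M B) :=
  RingHom.toAlgebra'
    { toFun := fun r => ⟨algebraMap R A r, 0, algebraMap R B r⟩
      map_one' := by ext <;> simp
      map_mul' := fun r s => by ext <;> simp
      map_zero' := by ext <;> simp
      map_add' := fun r s => by ext <;> simp }
    fun r x => by
      have h : MulOpposite.op (algebraMap R B r) • x.m = r • x.m := by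
        rw [← MulOpposite.algebraMap_apply, algebraMap_smul]
      ext
      · exact Algebra.commutes r x.a
      · simp [h]
      · exact Algebra.commutes r x.b

theorem smul_def (r : R) (x : TriMat A M B) : r • x = ⟨r • x.a, r • x.m, r • x.b⟩ := by
  rw [Algebra.smul_def]
  change (⟨algebraMap R A r, 0, algebraMap R B r⟩ : TriMat A M B) * x = _
  ext <;> simp [Algebra.smul_def]

instance [Module.Finite R A] [Module.Finite R B] [Module.Finite R M] :
    Module.Finite R (TriMat A M B) := by
  let f : (A × M × B) →ₗ[R] TriMat A M B :=
    { toFun := fun x => ⟨x.1, x.2.1, x.2.2⟩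
      map_add' := fun _ _ => rfl
      map_smul' := fun r x => by rw [smul_def]; rfl }
  exact Module.Finite.of_surjective f fun x => ⟨(x.a, x.m, x.b), rfl⟩

end Ring

section Components

variable {A M B : Type u} [Ring A] [Ring B] [AddCommGroup M] [Module A M] [Module Bᵐᵒᵖ M]
  [SMulCommClass A Bᵐᵒᵖ M]
variable {L : Type u} [AddCommGroup L] [Module (TriMat A M B) L]

variable (A M B L) in
/-- The projection `l ↦ e₁l`. -/
def topProj : L →+ topPart A M B L where
  toFun l := ⟨(⟨1, 0, 0⟩ : TriMat A M B) • l, by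
    change (⟨1, 0, 0⟩ : TriMat A M B) • (⟨1, 0, 0⟩ : TriMat A M B) • l = _
    rw [smul_smul]
    congr 1
    ext <;> simp⟩
  map_zero' := Subtype.ext (smul_zero _)
  map_add' _ _ := Subtype.ext (smul_add _ _ _)

variable (A M B L) in
/-- The projection `l ↦ e₂l`. -/
def botProj : L →+ botPart A M B L where
  toFun l := ⟨(⟨0, 0, 1⟩ : TriMat A M B) • l, by
    change (⟨0, 0, 1⟩ : TriMat A M B) • (⟨0, 0, 1⟩ : TriMat A M B) • l = _
    rw [smul_smul]
    congr 1
    ext <;> simp⟩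
  map_zero' := Subtype.ext (smul_zero _)
  map_add' _ _ := Subtype.ext (smul_add _ _ _)

theorem coe_topProj (l : L) : (topProj A M B L l : L) = (⟨1, 0, 0⟩ : TriMat A M B) • l := rfl

theorem coe_botProj (l : L) : (botProj A M B L l : L) = (⟨0, 0, 1⟩ : TriMat A M B) • l := rfl

theorem topProj_add_botProj (l : L) : (topProj A M B L l : L) + botProj A M B L l = l := by
  rw [coe_topProj, coe_botProj, ← add_smul]
  convert one_smul (TriMat A M B) l using 2
  ext <;> simp

theorem smul_coe_topPart (x : TriMat A M B) (l : topPart A M B L) :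
    x • (l : L) = (x.a • l : topPart A M B L) := by
  have h : (⟨1, 0, 0⟩ : TriMat A M B) • (l : L) = l := l.2
  rw [coe_smul_topPart, ← h, smul_smul, smul_smul]
  congr 1
  ext <;> simp

theorem smul_coe_botPart (x : TriMat A M B) (l : botPart A M B L) :
    x • (l : L) = pairing A M B L x.m l + (x.b • l : botPart A M B L) := by
  have h : (⟨0, 0, 1⟩ : TriMat A M B) • (l : L) = l := l.2
  rw [coe_smul_botPart, coe_pairing, ← add_smul]
  conv_lhs => rw [← h, smul_smul]
  congr 1
  ext <;> simp

@[simp]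
theorem topProj_coe_topPart (l : topPart A M B L) : topProj A M B L (l : L) = l := Subtype.ext l.2

@[simp]
theorem botProj_coe_botPart (l : botPart A M B L) : botProj A M B L (l : L) = l := Subtype.ext l.2

@[simp]
theorem topProj_coe_botPart (l : botPart A M B L) : topProj A M B L (l : L) = 0 :=
  Subtype.ext <| by
    rw [coe_topProj, smul_coe_botPart]
    simp

@[simp]
theorem botProj_coe_topPart (l : topPart A M B L) : botProj A M B L (l : L) = 0 :=
  Subtype.ext <| by
    rw [coe_botProj, smul_coe_topPart]
    simp

theorem botProj_smul (x : TriMat A M B) (l : L) :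
    botProj A M B L (x • l) = x.b • botProj A M B L l := by
  conv_lhs =>
    rw [← topProj_add_botProj (A := A) (M := M) (B := B) l, smul_add, smul_coe_topPart,
      smul_coe_botPart]
  simp

theorem topProj_smul (x : TriMat A M B) (l : L) :
    topProj A M B L (x • l) =
      x.a • topProj A M B L l + pairing A M B L x.m (botProj A M B L l) := by
  conv_lhs =>
    rw [← topProj_add_botProj (A := A) (M := M) (B := B) l, smul_add, smul_coe_topPart,
      smul_coe_botPart]
  simp

theorem structureMap_tmul (m : M) (y : botPart A M B L) :
    structureMap A M B L (BimoduleTensor.tmul A B m y) = pairing A M B L m y := rfl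

variable {L' : Type u} [AddCommGroup L'] [Module (TriMat A M B) L']

/-- The component `e₁L → e₁L'` of a linear map. -/
def topMap (f : L →ₗ[TriMat A M B] L') : topPart A M B L →ₗ[A] topPart A M B L' where
  toFun x := ⟨f x, by
    change _ • f x = f x
    rw [← map_smul]
    exact congrArg f x.2⟩
  map_add' _ _ := Subtype.ext (map_add f _ _)
  map_smul' _ _ := Subtype.ext (map_smul f _ _)

/-- The component `e₂L → e₂L'` of a linear map. -/
def botMap (f : L →ₗ[TriMat A M B] L') : botPart A M B L →ₗ[B] botPart A M B L' where
  toFun x := ⟨f x, by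
    change _ • f x = f x
    rw [← map_smul]
    exact congrArg f x.2⟩
  map_add' _ _ := Subtype.ext (map_add f _ _)
  map_smul' _ _ := Subtype.ext (map_smul f _ _)

@[simp]
theorem coe_topMap (f : L →ₗ[TriMat A M B] L') (x : topPart A M B L) : (topMap f x : L') = f x :=
  rfl

theorem topMap_surjective {f : L →ₗ[TriMat A M B] L'} (hf : Function.Surjective f) :
    Function.Surjective (topMap f) := by
  intro x
  obtain ⟨l, hl⟩ := hf x
  refine ⟨topProj A M B L l, Subtype.ext ?_⟩
  rw [coe_topMap, coe_topProj, map_smul, hl]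
  exact x.2

end Components

section Functors

variable (A M B : Type u) [Ring A] [Ring B] [AddCommGroup M] [Module A M] [Module Bᵐᵒᵖ M]
  [SMulCommClass A Bᵐᵒᵖ M]

/-- The functor `L ↦ e₁L`. -/
def topFunctor : ModuleCat.{u} (TriMat A M B) ⥤ ModuleCat.{u} A where
  obj L := ModuleCat.of A (topPart A M B L)
  map f := ModuleCat.ofHom (topMap f.hom)

/-- The functor `L ↦ e₂L`. -/
def botFunctor : ModuleCat.{u} (TriMat A M B) ⥤ ModuleCat.{u} B where
  obj L := ModuleCat.of B (botPart A M B L)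
  map f := ModuleCat.ofHom (botMap f.hom)

/-- The functor `X ↦ (X, 0)`. -/
noncomputable abbrev inflTop : ModuleCat.{u} A ⥤ ModuleCat.{u} (TriMat A M B) :=
  ModuleCat.restrictScalars (toTop A M B)

/-- The functor `Y ↦ (0, Y)`. -/
noncomputable abbrev inflBot : ModuleCat.{u} B ⥤ ModuleCat.{u} (TriMat A M B) :=
  ModuleCat.restrictScalars (toBot A M B)

instance : (botFunctor A M B).Additive where

instance : (topFunctor A M B).PreservesEpimorphisms where
  preserves f hf := (ModuleCat.epi_iff_surjective _).2
    (topMap_surjective ((ModuleCat.epi_iff_surjective f).1 hf))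

end Functors

section Column

variable (A M B : Type u) [Ring A] [Ring B] [AddCommGroup M] [Module A M] [Module Bᵐᵒᵖ M]

/-- The carrier of the `Λ`-module `(M ⊗_B Y, Y)` with structure map the identity. -/
def Column (Y : Type u) [AddCommGroup Y] [Module B Y] : Type u :=
  BimoduleTensor A M B Y × Y

namespace Column

section AddCommGroup

variable {A M B} {Y : Type u} [AddCommGroup Y] [Module B Y]

instance : AddCommGroup (Column A M B Y) :=
  inferInstanceAs (AddCommGroup (BimoduleTensor A M B Y × Y))

/-- The element `(t, y)` of `(M ⊗_B Y, Y)`. -/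
def mk (t : BimoduleTensor A M B Y) (y : Y) : Column A M B Y := (t, y)

/-- The component in `M ⊗_B Y`. -/
def top (v : Column A M B Y) : BimoduleTensor A M B Y := Prod.fst v

/-- The component in `Y`. -/
def bot (v : Column A M B Y) : Y := Prod.snd v

theorem ext {v w : Column A M B Y} (h₁ : v.top = w.top) (h₂ : v.bot = w.bot) : v = w :=
  Prod.ext h₁ h₂

@[simp] theorem top_mk (t : BimoduleTensor A M B Y) (y : Y) : (mk t y).top = t := rfl
@[simp] theorem bot_mk (t : BimoduleTensor A M B Y) (y : Y) : (mk t y).bot = y := rfl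
@[simp] theorem top_add (v w : Column A M B Y) : (v + w).top = v.top + w.top := rfl
@[simp] theorem bot_add (v w : Column A M B Y) : (v + w).bot = v.bot + w.bot := rfl
@[simp] theorem top_zero : (0 : Column A M B Y).top = 0 := rfl
@[simp] theorem bot_zero : (0 : Column A M B Y).bot = 0 := rfl

instance : SMul (TriMat A M B) (Column A M B Y) :=
  ⟨fun x v => mk (x.a • v.top + BimoduleTensor.tmul A B x.m v.bot) (x.b • v.bot)⟩

@[simp] theorem top_smul (x : TriMat A M B) (v : Column A M B Y) :
    (x • v).top = x.a • v.top + BimoduleTensor.tmul A B x.m v.bot := rfl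
@[simp] theorem bot_smul (x : TriMat A M B) (v : Column A M B Y) :
    (x • v).bot = x.b • v.bot := rfl

end AddCommGroup

variable {A M B} [SMulCommClass A Bᵐᵒᵖ M] {Y : Type u} [AddCommGroup Y] [Module B Y]

instance : Module (TriMat A M B) (Column A M B Y) where
  one_smul v := by apply ext <;> simp
  mul_smul x y v := by
    apply ext
    · simp only [top_smul, bot_smul, mul_a, mul_m, smul_add, BimoduleTensor.add_tmul,
        BimoduleTensor.op_smul_tmul, BimoduleTensor.smul_tmul, mul_smul, add_assoc]
    · simp [mul_smul]
  smul_zero x := by apply ext <;> simp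
  smul_add x v w := by
    apply ext
    · simp only [top_smul, top_add, bot_add, smul_add, BimoduleTensor.tmul_add]
      abel
    · simp
  add_smul x y v := by
    apply ext
    · simp only [top_smul, top_add, add_a, add_m, add_smul, BimoduleTensor.add_tmul]
      abel
    · simp [add_smul]
  zero_smul v := by apply ext <;> simp

variable (A M) in
/-- The map `(M ⊗ g, g)`. -/
def map {Y' : Type u} [AddCommGroup Y'] [Module B Y'] (g : Y →ₗ[B] Y') :
    Column A M B Y →ₗ[TriMat A M B] Column A M B Y' where
  toFun v := mk (BimoduleTensor.map A M g v.top) (g v.bot)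
  map_add' v w := by apply ext <;> simp
  map_smul' x v := by apply ext <;> simp [BimoduleTensor.map_tmul]

@[simp] theorem top_map {Y' : Type u} [AddCommGroup Y'] [Module B Y'] (g : Y →ₗ[B] Y')
    (v : Column A M B Y) : (map A M g v).top = BimoduleTensor.map A M g v.top := rfl
@[simp] theorem bot_map {Y' : Type u} [AddCommGroup Y'] [Module B Y'] (g : Y →ₗ[B] Y')
    (v : Column A M B Y) : (map A M g v).bot = g v.bot := rfl

variable {L : Type u} [AddCommGroup L] [Module (TriMat A M B) L]

/-- The linear map `(M ⊗_B Y, Y) → L` extending `g : Y → e₂L`. -/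
noncomputable def desc (g : Y →ₗ[B] botPart A M B L) : Column A M B Y →ₗ[TriMat A M B] L where
  toFun v := (structureMap A M B L (BimoduleTensor.map A M g v.top) : L) + g v.bot
  map_add' v w := by
    simp only [top_add, bot_add, map_add, AddSubgroup.coe_add]
    abel
  map_smul' x v := by
    rw [RingHom.id_apply, smul_add, smul_coe_topPart, smul_coe_botPart, top_smul, bot_smul,
      map_add, map_add, map_smul, map_smul, map_smul, BimoduleTensor.map_tmul, structureMap_tmul,
      AddSubgroup.coe_add, add_assoc]

theorem desc_apply (g : Y →ₗ[B] botPart A M B L) (v : Column A M B Y) :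
    desc g v = (structureMap A M B L (BimoduleTensor.map A M g v.top) : L) + g v.bot := rfl

theorem desc_mk_zero (g : Y →ₗ[B] botPart A M B L) (y : Y) : desc g (mk 0 y) = g y := by
  simp [desc_apply]

theorem hom_ext {f g : Column A M B Y →ₗ[TriMat A M B] L} (h : ∀ y, f (mk 0 y) = g (mk 0 y)) :
    f = g := by
  have h₁ (t : BimoduleTensor A M B Y) : f (mk t 0) = g (mk t 0) := by
    induction t using BimoduleTensor.induction_on with
    | zero => exact h 0
    | tmul m y =>
      have : mk (BimoduleTensor.tmul A B m y) 0 = (⟨0, m, 0⟩ : TriMat A M B) • mk 0 y := by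
        apply ext <;> simp
      rw [this, map_smul, map_smul, h]
    | add s t hs ht =>
      have : mk (s + t) (0 : Y) = mk s 0 + mk t 0 := by
        apply ext <;> simp
      rw [this, map_add, map_add, hs, ht]
  refine LinearMap.ext fun v => ?_
  have : v = mk v.top 0 + mk 0 v.bot := by
    apply ext <;> simp
  rw [this, map_add, map_add, h₁, h]

/-- The linear map `Y → e₂L` of a linear map `(M ⊗_B Y, Y) → L`. -/
def restrict (f : Column A M B Y →ₗ[TriMat A M B] L) : Y →ₗ[B] botPart A M B L where
  toFun y := ⟨f (mk 0 y), by
    change (⟨0, 0, 1⟩ : TriMat A M B) • f (mk 0 y) = _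
    rw [← map_smul]
    congr 1
    apply ext <;> simp⟩
  map_add' y y' := Subtype.ext <| by
    change f (mk 0 (y + y')) = f (mk 0 y) + f (mk 0 y')
    rw [← map_add]
    refine congrArg f (ext ?_ ?_) <;> simp
  map_smul' b y := Subtype.ext <| by
    change f (mk 0 (b • y)) = (⟨0, 0, b⟩ : TriMat A M B) • f (mk 0 y)
    rw [← map_smul]
    refine congrArg f (ext ?_ ?_) <;> simp

end Column

end Column

section Adjunctions

variable (A M B : Type u) [Ring A] [Ring B] [AddCommGroup M] [Module A M] [Module Bᵐᵒᵖ M]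
  [SMulCommClass A Bᵐᵒᵖ M]

/-- The functor `Y ↦ (M ⊗_B Y, Y)`. -/
def columnFunctor : ModuleCat.{u} B ⥤ ModuleCat.{u} (TriMat A M B) where
  obj Y := ModuleCat.of (TriMat A M B) (Column A M B Y)
  map f := ModuleCat.ofHom (Column.map A M f.hom)
  map_id Y := ModuleCat.hom_ext <| Column.hom_ext fun y => by apply Column.ext <;> simp
  map_comp f g := ModuleCat.hom_ext <| Column.hom_ext fun y => by apply Column.ext <;> simp

/-- `Y ↦ (M ⊗_B Y, Y)` is left adjoint to `L ↦ e₂L`. -/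
noncomputable def columnAdjunction : columnFunctor A M B ⊣ botFunctor A M B :=
  Adjunction.mkOfHomEquiv
    { homEquiv := fun Y L =>
        { toFun := fun f => ModuleCat.ofHom (Column.restrict f.hom)
          invFun := fun g => ModuleCat.ofHom (Column.desc (L := L) g.hom)
          left_inv := fun f => ModuleCat.hom_ext <| Column.hom_ext fun y =>
            Column.desc_mk_zero (Column.restrict f.hom) y
          right_inv := fun g => ModuleCat.hom_ext <| LinearMap.ext fun y => Subtype.ext <|
            Column.desc_mk_zero (L := L) g.hom y }
      homEquiv_naturality_left_symm := fun {X' X Y} f g => ModuleCat.hom_ext <| Column.hom_ext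
        fun y => by
          refine (Column.desc_mk_zero (L := Y) (g.hom ∘ₗ f.hom) y).trans
            ((Column.desc_mk_zero (L := Y) g.hom (f.hom y)).symm.trans ?_)
          refine congrArg (Column.desc (L := Y) g.hom) ?_
          apply Column.ext
          · exact (map_zero (BimoduleTensor.map A M f.hom)).symm
          · rfl
      homEquiv_naturality_right := fun _ _ => rfl }

/-- `X ↦ (X, 0)` is left adjoint to `L ↦ e₁L`. -/
noncomputable def inflTopAdjunction : inflTop A M B ⊣ topFunctor A M B :=
  Adjunction.mkOfHomEquiv
    { homEquiv := fun X L =>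
        { toFun := fun f => ModuleCat.ofHom (X := X) (Y := topPart A M B L)
            { toFun := fun x => ⟨f.hom (show (inflTop A M B).obj X from x),
                (map_smul f.hom (⟨1, 0, 0⟩ : TriMat A M B)
                  (show (inflTop A M B).obj X from x)).symm.trans
                  (congrArg f.hom (one_smul A (x : X)))⟩
              map_add' := fun x y => Subtype.ext (map_add f.hom
                (show (inflTop A M B).obj X from x) (show (inflTop A M B).obj X from y))
              map_smul' := fun a x => Subtype.ext (map_smul f.hom (⟨a, 0, 0⟩ : TriMat A M B)
                (show (inflTop A M B).obj X from x)) }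
          invFun := fun g =>
            let g' : X →ₗ[A] topPart A M B L := g.hom
            ModuleCat.ofHom (X := (inflTop A M B).obj X) (Y := L)
              { toFun := fun x => (g' x : L)
                map_add' := fun x y => congrArg Subtype.val (map_add g' x y)
                map_smul' := fun r x => (congrArg Subtype.val (map_smul g' r.a x)).trans
                  (smul_coe_topPart r (g' x)).symm }
          left_inv := fun _ => rfl
          right_inv := fun _ => rfl }
      homEquiv_naturality_left_symm := fun _ _ => rfl
      homEquiv_naturality_right := fun _ _ => rfl }

/-- `L ↦ e₂L` is left adjoint to `Y ↦ (0, Y)`. -/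
noncomputable def inflBotAdjunction : botFunctor A M B ⊣ inflBot A M B :=
  Adjunction.mkOfHomEquiv
    { homEquiv := fun L Y =>
        { toFun := fun f =>
            let f' : botPart A M B L →ₗ[B] Y := f.hom
            ModuleCat.ofHom (X := L) (Y := (inflBot A M B).obj Y)
              { toFun := fun l => f' (botProj A M B L l)
                map_add' := fun l l' =>
                  (congrArg f' (map_add (botProj A M B L) l l')).trans (map_add f' _ _)
                map_smul' := fun r l =>
                  (congrArg f' (botProj_smul r l)).trans (map_smul f' r.b _) }
          invFun := fun g => ModuleCat.ofHom (X := botPart A M B L) (Y := Y)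
            { toFun := fun y => g.hom (y : L)
              map_add' := fun y y' => map_add g.hom (y : L) (y' : L)
              map_smul' := fun b y => map_smul g.hom (⟨0, 0, b⟩ : TriMat A M B) (y : L) }
          left_inv := fun f => ModuleCat.hom_ext (LinearMap.ext fun y =>
            congrArg f.hom (botProj_coe_botPart (A := A) (M := M) (B := B) (L := L) y))
          right_inv := fun g => ModuleCat.hom_ext (LinearMap.ext fun l =>
            (map_smul g.hom (⟨0, 0, 1⟩ : TriMat A M B) (l : L)).trans
              (one_smul B (show Y from g.hom l))) }
      homEquiv_naturality_left_symm := fun _ _ => rfl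
      homEquiv_naturality_right := fun _ _ => rfl }

end Adjunctions

end TriMat

/-! ### Semi-Gorenstein-projective modules over the triangular matrix ring -/

section RestrictScalars

variable {S T : Type u} [Ring S] [Ring T]

theorem finite_restrictScalars_iff {f : S →+* T} (hf : Function.Surjective f)
    (X : ModuleCat.{u} T) :
    Module.Finite S ((ModuleCat.restrictScalars f).obj X) ↔ Module.Finite T X := by
  constructor
  · rintro ⟨s, hs⟩
    refine ⟨s, ?_⟩
    have key (x : (ModuleCat.restrictScalars f).obj X)
        (hx : x ∈ Submodule.span S (s : Set ((ModuleCat.restrictScalars f).obj X))) :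
        (show X from x) ∈ Submodule.span T ((show Finset X from s) : Set X) := by
      induction hx using Submodule.span_induction with
      | mem x hx => exact Submodule.subset_span hx
      | zero => exact Submodule.zero_mem _
      | add x y _ _ hx hy => exact Submodule.add_mem _ hx hy
      | smul a x _ hx => exact Submodule.smul_mem _ (f a) hx
    exact eq_top_iff.2 fun x _ => key x (hs ▸ Submodule.mem_top)
  · rintro ⟨s, hs⟩
    refine ⟨(show Finset ((ModuleCat.restrictScalars f).obj X) from s), ?_⟩
    have key (x : X) (hx : x ∈ Submodule.span T (s : Set X)) :
        (show (ModuleCat.restrictScalars f).obj X from x) ∈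
          Submodule.span S ((show Finset ((ModuleCat.restrictScalars f).obj X) from s) :
            Set ((ModuleCat.restrictScalars f).obj X)) := by
      induction hx using Submodule.span_induction with
      | mem x hx => exact Submodule.subset_span hx
      | zero => exact Submodule.zero_mem _
      | add x y _ _ hx hy => exact Submodule.add_mem _ hx hy
      | smul a x _ hx =>
        obtain ⟨a, rfl⟩ := hf a
        exact Submodule.smul_mem _ a hx
    exact eq_top_iff.2 fun x _ => key x (hs ▸ Submodule.mem_top)

/-- Restriction of scalars is exact. -/
theorem restrictScalars_map_exact (f : S →+* T) (C : ShortComplex (ModuleCat.{u} T))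
    (h : C.Exact) : (C.map (ModuleCat.restrictScalars.{u} f)).Exact := by
  rw [ShortComplex.ShortExact.moduleCat_exact_iff_function_exact] at h ⊢
  exact h

end RestrictScalars

namespace TriMat

variable {A M B : Type u} [Ring A] [Ring B] [AddCommGroup M] [Module A M] [Module Bᵐᵒᵖ M]
  [SMulCommClass A Bᵐᵒᵖ M]

theorem toTop_surjective : Function.Surjective (toTop A M B) := fun a => ⟨⟨a, 0, 0⟩, rfl⟩

theorem toBot_surjective : Function.Surjective (toBot A M B) := fun b => ⟨⟨0, 0, b⟩, rfl⟩

section Functors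

instance : Limits.PreservesFiniteLimits (inflTop A M B) := by
  have h := ((Functor.exact_tfae (inflTop A M B)).out 1 3).1 (restrictScalars_map_exact _)
  exact h.1

instance : Limits.PreservesFiniteColimits (inflTop A M B) := by
  have h := ((Functor.exact_tfae (inflTop A M B)).out 1 3).1 (restrictScalars_map_exact _)
  exact h.2

instance : (botFunctor A M B).PreservesEpimorphisms :=
  Functor.preservesEpimorphisms_of_adjunction (inflBotAdjunction A M B)

instance : (columnFunctor A M B).Additive :=
  (columnAdjunction A M B).left_adjoint_additive

theorem shortExact_map_botFunctor {S : ShortComplex (ModuleCat.{u} (TriMat A M B))}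
    (hS : S.ShortExact) : (S.map (botFunctor A M B)).ShortExact := by
  have := (columnAdjunction A M B).rightAdjoint_preservesLimits
  have := (inflBotAdjunction A M B).leftAdjoint_preservesColimits
  exact hS.map_of_exact _

theorem exists_projective_presentation {S : Type u} [Ring S] (X : ModuleCat.{u} S) :
    ∃ C : ShortComplex (ModuleCat.{u} S), C.ShortExact ∧ C.X₃ = X ∧ Projective C.X₂ :=
  ⟨X.projectiveShortComplex, X.shortExact_projectiveShortComplex, rfl, inferInstance⟩

/-- `Ext_Λ((X, 0), L)` vanishes if and only if `Ext_A(X, e₁L)` does. -/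
theorem extVanishes_inflTop_iff (X : ModuleCat.{u} A) (L : ModuleCat.{u} (TriMat A M B)) :
    ExtVanishes ((inflTop A M B).obj X) L ↔ ExtVanishes X ((topFunctor A M B).obj L) :=
  (inflTopAdjunction A M B).extVanishes_iff (fun _ => True) (fun X _ =>
    have ⟨S, hS, hX, hP⟩ := exists_projective_presentation X
    ⟨S, hS, hX, hP, trivial, hS.map_of_exact _⟩) trivial L

/-- `Ext_Λ(L, (0, N))` vanishes if and only if `Ext_B(e₂L, N)` does. -/
theorem extVanishes_inflBot_iff (L : ModuleCat.{u} (TriMat A M B)) (N : ModuleCat.{u} B) :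
    ExtVanishes ((botFunctor A M B).obj L) N ↔ ExtVanishes L ((inflBot A M B).obj N) :=
  (inflBotAdjunction A M B).extVanishes_iff (fun _ => True) (fun X _ =>
    have ⟨S, hS, hX, hP⟩ := exists_projective_presentation X
    ⟨S, hS, hX, hP, trivial, shortExact_map_botFunctor hS⟩) trivial N

theorem isZero_botFunctor_inflTop (X : ModuleCat.{u} A) :
    Limits.IsZero ((botFunctor A M B).obj ((inflTop A M B).obj X)) := by
  have : Subsingleton (botPart A M B ((inflTop A M B).obj X)) := by
    refine subsingleton_of_forall_eq 0 fun y => Subtype.ext ?_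
    have h : (⟨0, 0, 1⟩ : TriMat A M B) • (y : (inflTop A M B).obj X) = y := y.2
    rw [← h]
    exact zero_smul A (show X from (y : (inflTop A M B).obj X))
  exact ModuleCat.isZero_of_subsingleton (ModuleCat.of B (botPart A M B ((inflTop A M B).obj X)))

variable (M B) in
/-- The component `e₁(X, 0)` is `X`. -/
noncomputable def topFunctorInflTopIso (X : ModuleCat.{u} A) :
    (topFunctor A M B).obj ((inflTop A M B).obj X) ≅ X :=
  LinearEquiv.toModuleIso (X₁ := topPart A M B ((inflTop A M B).obj X)) (X₂ := X)
    { toFun := fun x => (x : (inflTop A M B).obj X)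
      map_add' := fun _ _ => rfl
      map_smul' := fun _ _ => rfl
      invFun := fun x => ⟨(show (inflTop A M B).obj X from x), one_smul A (x : X)⟩
      left_inv := fun _ => rfl
      right_inv := fun _ => rfl }

variable (A M) in
/-- The component `e₂(M ⊗_B Y, Y)` is `Y`. -/
def botPartColumnEquiv (Y : Type u) [AddCommGroup Y] [Module B Y] :
    botPart A M B (Column A M B Y) ≃ₗ[B] Y where
  toFun v := Column.bot (v : Column A M B Y)
  map_add' _ _ := rfl
  map_smul' _ _ := rfl
  invFun y := ⟨Column.mk 0 y, Column.ext (by simp) (by simp)⟩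
  left_inv v := by
    apply Subtype.ext
    have h : (⟨0, 0, 1⟩ : TriMat A M B) • (v : Column A M B Y) = v := v.2
    have h' := congrArg Column.top h
    rw [Column.top_smul, zero_smul, BimoduleTensor.zero_tmul, add_zero] at h'
    exact Column.ext h' rfl
  right_inv _ := rfl

theorem eq_zero_of_column_inflTop {Y : Type u} [AddCommGroup Y] [Module B Y] (X : ModuleCat.{u} A)
    (f : Column A M B Y →ₗ[TriMat A M B] (inflTop A M B).obj X) : f = 0 := by
  refine Column.hom_ext fun y => ?_
  have h : Column.mk 0 y = (⟨0, 0, 1⟩ : TriMat A M B) • (Column.mk 0 y : Column A M B Y) := by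
    apply Column.ext <;> simp
  rw [h, map_smul]
  exact zero_smul A (show X from f (Column.mk 0 y))

end Functors

section Finite

theorem finite_inflTop_iff (X : ModuleCat.{u} A) :
    Module.Finite (TriMat A M B) ((inflTop A M B).obj X) ↔ Module.Finite A X :=
  finite_restrictScalars_iff toTop_surjective X

theorem finite_botPart (L : Type u) [AddCommGroup L] [Module (TriMat A M B) L]
    [Module.Finite (TriMat A M B) L] : Module.Finite B (botPart A M B L) := by
  let Y : ModuleCat.{u} B := ModuleCat.of B (botPart A M B L)
  refine (finite_restrictScalars_iff (toBot_surjective (A := A) (M := M)) Y).1 ?_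
  let p : L →ₗ[TriMat A M B] (inflBot A M B).obj Y :=
    { toFun := fun l => botProj A M B L l
      map_add' := fun l l' => map_add (botProj A M B L) l l'
      map_smul' := fun x l => botProj_smul x l }
  exact Module.Finite.of_surjective p fun y =>
    ⟨((show botPart A M B L from y) : L), botProj_coe_botPart _⟩

instance Column.finite (Y : Type u) [AddCommGroup Y] [Module B Y] [Module.Finite B Y] :
    Module.Finite (TriMat A M B) (Column A M B Y) := by
  classical
  obtain ⟨s, hs⟩ := ‹Module.Finite B Y›
  refine ⟨s.image (Column.mk 0), ?_⟩
  rw [eq_top_iff]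
  rintro v -
  set T := Submodule.span (TriMat A M B)
    ((s.image (Column.mk 0) : Finset (Column A M B Y)) : Set (Column A M B Y))
  have h₀ (y : Y) : Column.mk 0 y ∈ T := by
    have hy : y ∈ Submodule.span B (s : Set Y) := hs ▸ Submodule.mem_top
    induction hy using Submodule.span_induction with
    | mem y hy => exact Submodule.subset_span (by simpa using ⟨y, hy, rfl⟩)
    | zero => exact T.zero_mem
    | add y y' _ _ hy hy' =>
      convert T.add_mem hy hy' using 1
      apply Column.ext <;> simp
    | smul b y _ hy =>
      convert T.smul_mem (⟨0, 0, b⟩ : TriMat A M B) hy using 1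
      apply Column.ext <;> simp
  have h₁ (t : BimoduleTensor A M B Y) : Column.mk t 0 ∈ T := by
    induction t using BimoduleTensor.induction_on with
    | zero => exact T.zero_mem
    | tmul m y =>
      convert T.smul_mem (⟨0, m, 0⟩ : TriMat A M B) (h₀ y) using 1
      apply Column.ext <;> simp
    | add t t' ht ht' =>
      convert T.add_mem ht ht' using 1
      apply Column.ext <;> simp
  convert T.add_mem (h₁ v.top) (h₀ v.bot) using 1
  apply Column.ext <;> simp

end Finite

section RegularModule

variable (A M B) in
/-- The inclusion of the first row `(A ⊕ M, 0)` into `Λ`. -/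
noncomputable def rowInclusion :
    (inflTop A M B).obj (ModuleCat.of A (A × M)) →ₗ[TriMat A M B] TriMat A M B where
  toFun x := ⟨(show A × M from x).1, (show A × M from x).2, 0⟩
  map_add' x y := by
    change (⟨_, _, 0⟩ : TriMat A M B) = ⟨_, _, 0 + 0⟩
    rw [add_zero]
    rfl
  map_smul' r x := by
    change (⟨r.a * (show A × M from x).1, r.a • (show A × M from x).2, 0⟩ : TriMat A M B) =
      r * ⟨(show A × M from x).1, (show A × M from x).2, 0⟩
    ext <;> simp

variable (A M B) in
/-- The projection of `Λ` onto `(0, B)`. -/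
noncomputable def toInflBot :
    TriMat A M B →ₗ[TriMat A M B] (inflBot A M B).obj (ModuleCat.of B B) where
  toFun x := x.b
  map_add' _ _ := rfl
  map_smul' _ _ := rfl

theorem shortExact_regular (A M B : Type u) [Ring A] [Ring B] [AddCommGroup M] [Module A M]
    [Module Bᵐᵒᵖ M] [SMulCommClass A Bᵐᵒᵖ M] :
    (ModuleCat.shortComplexOfCompEqZero (rowInclusion A M B) (toInflBot A M B)
      (LinearMap.ext fun _ => rfl)).ShortExact := by
  refine ModuleCat.shortComplex_shortExact _ ?_ ?_ ?_
  · intro x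
    constructor
    · intro h
      exact ⟨(show A × M from (TriMat.a x, TriMat.m x)), TriMat.ext rfl rfl (Eq.symm h)⟩
    · rintro ⟨y, rfl⟩
      rfl
  · intro x y h
    exact Prod.ext (congrArg TriMat.a h) (congrArg TriMat.m h)
  · intro b
    exact ⟨(⟨0, 0, b⟩ : TriMat A M B), rfl⟩

/-- The projection of `Λ` onto its direct summand `(A, 0)`, the first column. -/
noncomputable def firstColumnRetract :
    Retract ((inflTop A M B).obj (ModuleCat.of A A))
      (ModuleCat.of (TriMat A M B) (TriMat A M B)) where
  i := ModuleCat.ofHom (X := (inflTop A M B).obj (ModuleCat.of A A))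
    { toFun := fun x => (⟨x, 0, 0⟩ : TriMat A M B)
      map_add' := fun x y => by
        change (⟨_, 0, 0⟩ : TriMat A M B) = ⟨_, 0 + 0, 0 + 0⟩
        rw [add_zero, add_zero]
        rfl
      map_smul' := fun r x => by
        change (⟨r.a * (show A from x), 0, 0⟩ : TriMat A M B) = r * ⟨(show A from x), 0, 0⟩
        ext <;> simp }
  r := ModuleCat.ofHom (Y := (inflTop A M B).obj (ModuleCat.of A A))
    { toFun := fun x : TriMat A M B => x.a
      map_add' := fun _ _ => rfl
      map_smul' := fun _ _ => rfl }
  retract := rfl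

/-- If `_AM` has finite projective dimension, a `Λ`-module `L` is semi-Gorenstein-projective if and
only if `e₂L` is semi-Gorenstein-projective and `Ext^i_Λ(L, (A, 0)) = 0` for all `i ≥ 1`. -/
theorem isSemiGorensteinProjective_iff [IsNoetherianRing A] [Module.Finite A M]
    (hM : projectiveDimension (ModuleCat.of A M) < ⊤) (L : ModuleCat.{u} (TriMat A M B)) :
    IsSemiGorensteinProjective (TriMat A M B) L ↔ Module.Finite (TriMat A M B) L ∧
      IsSemiGorensteinProjective B (ModuleCat.of B (botPart A M B L)) ∧
      ExtVanishes L ((inflTop A M B).obj (ModuleCat.of A A)) := by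
  have row (h : ExtVanishes L ((inflTop A M B).obj (ModuleCat.of A A))) :
      ExtVanishes L ((inflTop A M B).obj (ModuleCat.of A (A × M))) := by
    obtain ⟨n, hn⟩ := exists_hasProjectiveDimensionLT_of_lt_top hM
    exact ExtVanishes.map_prod _ h (ExtVanishes.map_of_hasProjectiveDimensionLT _ h n M hn)
  constructor
  · intro h
    have hfin : Module.Finite (TriMat A M B) L := h.1
    have hA : ExtVanishes L ((inflTop A M B).obj (ModuleCat.of A A)) :=
      ExtVanishes.of_retract_right firstColumnRetract h.2
    refine ⟨h.1, ⟨finite_botPart L, ?_⟩, hA⟩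
    exact (extVanishes_inflBot_iff L (ModuleCat.of B B)).2
      (ExtVanishes.right_X₃ (shortExact_regular A M B) (row hA) h.2)
  · rintro ⟨h, hB, hA⟩
    exact ⟨h, ExtVanishes.right_X₂ (shortExact_regular A M B) (row hA)
      ((extVanishes_inflBot_iff L (ModuleCat.of B B)).1 hB.2)⟩

/-- `(X, 0)` is semi-Gorenstein-projective if `X` is. -/
theorem isSemiGorensteinProjective_inflTop [IsNoetherianRing A] [Module.Finite A M]
    (hM : projectiveDimension (ModuleCat.of A M) < ⊤) {X : ModuleCat.{u} A}
    (hX : IsSemiGorensteinProjective A X) :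
    IsSemiGorensteinProjective (TriMat A M B) ((inflTop A M B).obj X) := by
  have h0 := isZero_botFunctor_inflTop (M := M) (B := B) X
  have hfin : Module.Finite (TriMat A M B) ((inflTop A M B).obj X) :=
    (finite_inflTop_iff X).2 hX.1
  refine (isSemiGorensteinProjective_iff hM _).2 ⟨hfin, ⟨finite_botPart _, ?_⟩,
    (extVanishes_inflTop_iff _ _).2
      (ExtVanishes.of_iso_right (topFunctorInflTopIso M B (ModuleCat.of A A)) hX.2)⟩
  have : Projective ((botFunctor A M B).obj ((inflTop A M B).obj X)) := h0.projective
  exact ExtVanishes.of_projective ((botFunctor A M B).obj ((inflTop A M B).obj X)) _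

end RegularModule

section Column

variable {R : Type u} [CommRing R] [IsArtinianRing R] [Algebra R A] [Algebra R B] [Module R M]
  [IsScalarTower R A M] [IsScalarTower R Bᵐᵒᵖ M]

/-- If `D(M)` lies in `(⊥B)^⊥`, then `Y ↦ (M ⊗_B Y, Y)` is exact on presentations of
semi-Gorenstein-projective modules. -/
theorem shortExact_map_columnFunctor
    (H : ModuleCat.of B (ArtinDual R M) ∈ rightPerp B (leftPerp B (ModuleCat.of B B)))
    {Y : Type u} [AddCommGroup Y] [Module B Y]
    (hY : IsSemiGorensteinProjective B (ModuleCat.of B Y)) {n : ℕ} {g : (Fin n → B) →ₗ[B] Y}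
    (hg : Function.Surjective g) :
    ((ModuleCat.shortComplexOfCompEqZero (LinearMap.ker g).subtype g
      (LinearMap.exact_subtype_ker_map g).linearMap_comp_eq_zero).map
        (columnFunctor A M B)).ShortExact := by
  have hS := shortExact_of_linearMap (LinearMap.ker g).injective_subtype
    (LinearMap.exact_subtype_ker_map g) hg
  have := (columnAdjunction A M B).leftAdjoint_preservesColimits
  have := hS.epi_g
  refine
    { exact := hS.exact.map_of_epi_of_preservesCokernel _ inferInstance inferInstance
      mono_f := ?_
      epi_g := inferInstanceAs (Epi ((columnFunctor A M B).map (ModuleCat.ofHom g))) }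
  refine (ModuleCat.mono_iff_injective _).2 ?_
  change Function.Injective (Column.map A M (LinearMap.ker g).subtype)
  rw [injective_iff_map_eq_zero]
  intro v hv
  refine Column.ext ?_ ((LinearMap.ker g).injective_subtype (congrArg Column.bot hv))
  refine BimoduleTensor.eq_zero_of_contract_eq_zero R (LinearMap.ker g).subtype
    (ExtVanishes.exists_linearMap_extension (LinearMap.ker g).injective_subtype
      (LinearMap.exact_subtype_ker_map g) hg (H _ hY)) fun j => ?_
  rw [← BimoduleTensor.contract_map]
  have hv' : BimoduleTensor.map A M (LinearMap.ker g).subtype v.top = 0 := congrArg Column.top hv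
  rw [hv', map_zero]

/-- For semi-Gorenstein-projective `Y`, the groups `Ext^i((M ⊗_B Y, Y), (X, 0))` with `i ≥ 1`
vanish: by adjunction they are `Ext^i_B(Y, e₂(X, 0))`, and `e₂(X, 0) = 0`. -/
theorem extVanishes_column_inflTop [IsNoetherianRing B]
    (H : ModuleCat.of B (ArtinDual R M) ∈ rightPerp B (leftPerp B (ModuleCat.of B B)))
    {Y : Type u} [AddCommGroup Y] [Module B Y]
    (hY : IsSemiGorensteinProjective B (ModuleCat.of B Y)) (X : ModuleCat.{u} A) :
    ExtVanishes (ModuleCat.of (TriMat A M B) (Column A M B Y)) ((inflTop A M B).obj X) := by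
  refine ((columnAdjunction A M B).extVanishes_iff (IsSemiGorensteinProjective B) ?_ hY
    ((inflTop A M B).obj X)).2 (.of_isZero_right _ (isZero_botFunctor_inflTop X))
  intro Y hY
  have hfin : Module.Finite B Y := hY.1
  obtain ⟨n, g, hg, -⟩ := exists_finite_free_presentation (A := B) Y
  exact ⟨_, shortExact_of_linearMap (LinearMap.ker g).injective_subtype
    (LinearMap.exact_subtype_ker_map g) hg, rfl,
    ModuleCat.projective_of_categoryTheory_projective (ModuleCat.of B (Fin n → B)),
    IsSemiGorensteinProjective.ker hY hg, shortExact_map_columnFunctor H hY hg⟩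

/-- `(M ⊗_B Y, Y)` is semi-Gorenstein-projective if `Y` is. -/
theorem isSemiGorensteinProjective_column [IsNoetherianRing A] [IsNoetherianRing B]
    [Module.Finite A M] (hM : projectiveDimension (ModuleCat.of A M) < ⊤)
    (H : ModuleCat.of B (ArtinDual R M) ∈ rightPerp B (leftPerp B (ModuleCat.of B B)))
    {Y : Type u} [AddCommGroup Y] [Module B Y]
    (hY : IsSemiGorensteinProjective B (ModuleCat.of B Y)) :
    IsSemiGorensteinProjective (TriMat A M B)
      (ModuleCat.of (TriMat A M B) (Column A M B Y)) := by
  have hfin : Module.Finite B Y := hY.1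
  exact (isSemiGorensteinProjective_iff hM _).2 ⟨Column.finite Y, ⟨finite_botPart _,
    ExtVanishes.of_iso_left (botPartColumnEquiv A M Y).toModuleIso hY.2⟩,
    extVanishes_column_inflTop H hY _⟩

end Column

end TriMat

/-! ### Monic modules and the weakly Gorenstein property of the triangular matrix ring -/

namespace TriMat

variable {A M B : Type u} [Ring A] [Ring B] [AddCommGroup M] [Module A M] [Module Bᵐᵒᵖ M]
  [SMulCommClass A Bᵐᵒᵖ M]

section LinearForms

variable {L : Type u} [AddCommGroup L] [Module (TriMat A M B) L]

theorem apply_botPart (f : L →ₗ[TriMat A M B] TriMat A M B) (y : botPart A M B L) :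
    f y = ⟨0, 0, (f y).b⟩ := by
  have h : (⟨0, 0, 1⟩ : TriMat A M B) • (y : L) = y := y.2
  have h' : f y = (⟨0, 0, 1⟩ : TriMat A M B) * f y := by
    conv_lhs => rw [← h, map_smul, smul_eq_mul]
  rw [h']
  ext <;> simp

/-- The component `e₂L → e₂Λ = B` of a linear form on `L`. -/
def botForm (f : L →ₗ[TriMat A M B] TriMat A M B) : botPart A M B L →ₗ[B] B where
  toFun y := (f y).b
  map_add' y y' := by rw [AddSubgroup.coe_add, map_add, add_b]
  map_smul' b y := by
    rw [coe_smul_botPart, map_smul, smul_eq_mul, mul_b]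
    rfl

theorem contract_botForm (f : L →ₗ[TriMat A M B] TriMat A M B)
    (t : BimoduleTensor A M B (botPart A M B L)) :
    BimoduleTensor.contract A M (botForm f) t = (f (structureMap A M B L t)).m := by
  induction t using BimoduleTensor.induction_on with
  | zero => simp
  | add s t hs ht => simp [hs, ht]
  | tmul m y =>
    rw [BimoduleTensor.contract_tmul, structureMap_tmul, coe_pairing, map_smul, smul_eq_mul,
      mul_m, zero_smul, zero_add]
    rfl

end LinearForms

section

variable {R : Type u} [CommRing R] [IsArtinianRing R] [Algebra R A] [Algebra R B] [Module R M]
  [IsScalarTower R A M] [IsScalarTower R Bᵐᵒᵖ M]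

/-- For a semi-Gorenstein-projective module `L` with semi-Gorenstein-projective cokernel `L'` of an
embedding into `Λ^n`, the map `M ⊗_B e₂L → M ⊗_B e₂Λ^n = M^n` is injective, as
`Ext¹_B(e₂L', D(M)) = 0`; and it factors through the structure map of `L`. -/
theorem isMonic_of_isWeaklyGorenstein [IsNoetherianRing A] [Module.Finite A M]
    [IsNoetherianRing (TriMat A M B)ᵐᵒᵖ] (hM : projectiveDimension (ModuleCat.of A M) < ⊤)
    (H : ModuleCat.of B (ArtinDual R M) ∈ rightPerp B (leftPerp B (ModuleCat.of B B)))
    (hΛ : IsWeaklyGorenstein (TriMat A M B)) {L : ModuleCat.{u} (TriMat A M B)}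
    (hL : IsSemiGorensteinProjective (TriMat A M B) L) : IsMonic A M B L := by
  rw [IsMonic, injective_iff_map_eq_zero]
  intro t ht
  obtain ⟨n, ι, hι, -, hcok⟩ := hL.exists_embedding (hΛ L hL).2.2.1
  have hS := shortExact_of_linearMap hι (LinearMap.exact_map_mkQ_range ι)
    (Submodule.mkQ_surjective _)
  let col : (Fin n → B) →ₗ[B] botPart A M B (Fin n → TriMat A M B) :=
    { toFun := fun v => ⟨fun j => ⟨0, 0, v j⟩, funext fun j => by
        change (⟨0, 0, 1⟩ : TriMat A M B) * ⟨0, 0, v j⟩ = _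
        ext <;> simp⟩
      map_add' := fun v w => Subtype.ext <| funext fun j => by
        change (⟨0, 0, v j + w j⟩ : TriMat A M B) = ⟨0, 0, v j⟩ + ⟨0, 0, w j⟩
        ext <;> simp
      map_smul' := fun b v => Subtype.ext <| funext fun j => by
        change (⟨0, 0, b * v j⟩ : TriMat A M B) = ⟨0, 0, b⟩ * ⟨0, 0, v j⟩
        ext <;> simp }
  let ιB : botPart A M B L →ₗ[B] (Fin n → B) :=
    LinearMap.pi fun j => botForm (LinearMap.proj j ∘ₗ ι)
  have hcol (y : botPart A M B L) : col (ιB y) = botMap ι y :=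
    Subtype.ext <| funext fun j =>
      (apply_botPart (LinearMap.proj j ∘ₗ ι : L →ₗ[TriMat A M B] TriMat A M B) y).symm
  refine BimoduleTensor.eq_zero_of_contract_eq_zero R ιB (fun β => ?_) fun j => ?_
  · obtain ⟨γ, hγ⟩ := ExtVanishes.exists_extension (shortExact_map_botFunctor hS)
      (H _ ((isSemiGorensteinProjective_iff hM _).1 hcok).2.1) (ModuleCat.ofHom β)
    let γ' : botPart A M B (Fin n → TriMat A M B) →ₗ[B] ArtinDual R M := γ.hom
    refine ⟨γ' ∘ₗ col, LinearMap.ext fun y => ?_⟩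
    rw [LinearMap.comp_apply, LinearMap.comp_apply, hcol]
    exact LinearMap.congr_fun (congrArg ModuleCat.Hom.hom hγ) y
  · have h := contract_botForm (LinearMap.proj j ∘ₗ ι : L →ₗ[TriMat A M B] TriMat A M B) t
    rw [ht] at h
    refine h.trans ?_
    simp

/-- If `Λ` is weakly Gorenstein, so is `A`. For semi-Gorenstein-projective `X` let
`(X, 0) → Λ^n` be an embedding with semi-Gorenstein-projective cokernel. Its components with values
in `M` are the images of tensors `∑ mⱼ ⊗ yⱼ` under the structure map of the cokernel, which is
monic; hence `X ∩ M^n = 0`. -/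
theorem isWeaklyGorenstein_top [IsNoetherianRing A] [IsNoetherianRing Aᵐᵒᵖ] [Module.Finite A M]
    [IsNoetherianRing (TriMat A M B)ᵐᵒᵖ] (hM : projectiveDimension (ModuleCat.of A M) < ⊤)
    (H : ModuleCat.of B (ArtinDual R M) ∈ rightPerp B (leftPerp B (ModuleCat.of B B)))
    (hΛ : IsWeaklyGorenstein (TriMat A M B)) : IsWeaklyGorenstein A := by
  refine isWeaklyGorenstein_of_torsionless fun X hX => bidualMap_injective_iff.2 fun x hx => ?_
  have hL := isSemiGorensteinProjective_inflTop (B := B) hM hX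
  have hemb (L : ModuleCat.{u} (TriMat A M B)) (hL : IsSemiGorensteinProjective _ L) :=
    hL.exists_embedding (hΛ L hL).2.2.1
  obtain ⟨n, ι, hι, -, hcok⟩ := hemb _ hL
  have hmonic := isMonic_of_isWeaklyGorenstein (R := R) hM H hΛ hcok
  -- the components of `ι` have no entry in `B`
  have hb (x : (inflTop A M B).obj X) (j : Fin n) : (ι x j).b = 0 := by
    have h1 : (⟨1, 0, 0⟩ : TriMat A M B) • x = x := one_smul A (show X from x)
    have h2 : ι x = (⟨1, 0, 0⟩ : TriMat A M B) • ι x := by rw [← map_smul, h1]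
    have h3 := congrArg TriMat.b (congrFun h2 j)
    rwa [Pi.smul_apply, smul_eq_mul, mul_b, zero_mul] at h3
  let x' : (inflTop A M B).obj X := x
  have ha (j : Fin n) : (ι x' j).a = 0 := hx
    { toFun := fun z => (ι (show (inflTop A M B).obj X from z) j).a
      map_add' := fun z w => congrArg (fun v => (v j).a)
        (map_add ι (show (inflTop A M B).obj X from z) (show (inflTop A M B).obj X from w))
      map_smul' := fun a z => congrArg (fun v => (v j).a)
        (map_smul ι (⟨a, 0, 0⟩ : TriMat A M B) (show (inflTop A M B).obj X from z)) }
  -- the tensor `∑ mⱼ ⊗ yⱼ`, where `yⱼ` is the image of the `j`-th unit vector of `B^n`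
  let π := (LinearMap.range ι).mkQ
  let e (j : Fin n) : botPart A M B (Fin n → TriMat A M B) :=
    botProj A M B _ (Pi.single j 1)
  let t : BimoduleTensor A M B (botPart A M B ((Fin n → TriMat A M B) ⧸ LinearMap.range ι)) :=
    ∑ j, BimoduleTensor.tmul A B (ι x' j).m (botMap π (e j))
  have ht : structureMap A M B _ t = 0 := by
    apply Subtype.ext
    have h1 : (structureMap A M B _ t : (Fin n → TriMat A M B) ⧸ LinearMap.range ι) =
        ∑ j, (⟨0, (ι x' j).m, 0⟩ : TriMat A M B) • π (e j) := by
      rw [map_sum, AddSubgroup.val_finsetSum]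
      rfl
    have h2 : ι x' = ∑ j, (⟨0, (ι x' j).m, 0⟩ : TriMat A M B) •
        (e j : Fin n → TriMat A M B) := by
      funext i
      rw [Finset.sum_apply, Finset.sum_eq_single i]
      · change ι x' i = (⟨0, (ι x' i).m, 0⟩ : TriMat A M B) *
          ((⟨0, 0, 1⟩ : TriMat A M B) * (Pi.single i 1 : Fin n → TriMat A M B) i)
        rw [Pi.single_eq_same, mul_one]
        ext
        · simp [ha]
        · simp
        · simp [hb]
      · intro j _ hji
        change (⟨0, (ι x' j).m, 0⟩ : TriMat A M B) *
          ((⟨0, 0, 1⟩ : TriMat A M B) * (Pi.single j 1 : Fin n → TriMat A M B) i) = 0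
        rw [Pi.single_eq_of_ne hji.symm, mul_zero, mul_zero]
      · simp
    rw [h1]
    simp_rw [← map_smul]
    rw [← map_sum, ← h2]
    exact (Submodule.Quotient.mk_eq_zero _).2 ⟨x', rfl⟩
  have ht0 : t = 0 := (injective_iff_map_eq_zero _).1 hmonic t ht
  -- the `B`-coordinates on `Λ^n` vanish on `X`, so they are defined on the cokernel
  let coord : ((Fin n → TriMat A M B) ⧸ LinearMap.range ι) →ₗ[TriMat A M B]
      (inflBot A M B).obj (ModuleCat.of B (Fin n → B)) :=
    (LinearMap.range ι).liftQ
      { toFun := fun v => (fun j => (v j).b : Fin n → B)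
        map_add' := fun _ _ => rfl
        map_smul' := fun _ _ => rfl } <| by
      rintro _ ⟨z, rfl⟩
      exact funext fun j => hb z j
  let g (i : Fin n) : botPart A M B ((Fin n → TriMat A M B) ⧸ LinearMap.range ι) →ₗ[B] B :=
    { toFun := fun y => (show Fin n → B from coord y) i
      map_add' := fun y y' => congrFun (map_add coord (y : _ ⧸ LinearMap.range ι) y') i
      map_smul' := fun b y => congrFun (map_smul coord (⟨0, 0, b⟩ : TriMat A M B)
        (y : _ ⧸ LinearMap.range ι)) i }
  have hg (i j : Fin n) : g i (botMap π (e j)) = if i = j then 1 else 0 := by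
    change (((⟨0, 0, 1⟩ : TriMat A M B) * (Pi.single j 1 : Fin n → TriMat A M B) i)).b = _
    rw [Pi.single_apply]
    split_ifs <;> simp
  have hm (i : Fin n) : (ι x' i).m = 0 := by
    have h1 : BimoduleTensor.contract A M (g i) t = (ι x' i).m := by
      rw [map_sum, Finset.sum_eq_single i]
      · rw [BimoduleTensor.contract_tmul, hg, if_pos rfl, MulOpposite.op_one, one_smul]
      · intro j _ hji
        rw [BimoduleTensor.contract_tmul, hg, if_neg hji.symm, MulOpposite.op_zero, zero_smul]
      · simp
    rw [← h1, ht0, map_zero]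
  have h0 : ι x' = 0 := funext fun j => TriMat.ext (ha j) (hm j) (hb x' j)
  exact hι (h0.trans (map_zero ι).symm)

/-- If `Λ` is weakly Gorenstein, so is `B`: linear forms on `(M ⊗_B Y, Y)` restrict to linear forms
on `Y`. -/
theorem isWeaklyGorenstein_bot [IsNoetherianRing A] [IsNoetherianRing B] [IsNoetherianRing Bᵐᵒᵖ]
    [Module.Finite A M] (hM : projectiveDimension (ModuleCat.of A M) < ⊤)
    (H : ModuleCat.of B (ArtinDual R M) ∈ rightPerp B (leftPerp B (ModuleCat.of B B)))
    (hΛ : IsWeaklyGorenstein (TriMat A M B)) : IsWeaklyGorenstein B := by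
  refine isWeaklyGorenstein_of_torsionless fun Y hY => bidualMap_injective_iff.2 fun y hy => ?_
  have hL := isSemiGorensteinProjective_column hM H hY
  have h := bidualMap_injective_iff.1 (hΛ _ hL).2.2.1 (Column.mk 0 y) fun f => ?_
  · exact congrArg Column.bot h
  · let e : Y ≃ₗ[B] botPart A M B (Column A M B Y) := (botPartColumnEquiv A M Y).symm
    have h1 := apply_botPart f (e y)
    have h2 : (f (e y : Column A M B Y)).b = 0 := hy (botForm f ∘ₗ e.toLinearMap)
    rw [h2] at h1
    exact h1

/-- For semi-Gorenstein-projective `Y` over a weakly Gorenstein ring `B`, the elements of `M ⊗_B Y`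
are separated by the maps `M ⊗_B Y → M` given by linear forms on `Y`. -/
theorem tensor_eq_zero_of_contract [IsNoetherianRing Bᵐᵒᵖ]
    (H : ModuleCat.of B (ArtinDual R M) ∈ rightPerp B (leftPerp B (ModuleCat.of B B)))
    (hB : IsWeaklyGorenstein B) {Y : ModuleCat.{u} B} (hY : IsSemiGorensteinProjective B Y)
    {t : BimoduleTensor A M B Y}
    (ht : ∀ g : Y →ₗ[B] B, BimoduleTensor.contract A M g t = 0) : t = 0 := by
  obtain ⟨n, ι, hι, -, hcok⟩ := hY.exists_embedding (hB Y hY).2.2.1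
  exact BimoduleTensor.eq_zero_of_contract_eq_zero R ι
    (ExtVanishes.exists_linearMap_extension hι (LinearMap.exact_map_mkQ_range ι)
      (Submodule.mkQ_surjective _) (H _ hcok)) fun j => ht _

end

section Cokernel

variable {L : Type u} [AddCommGroup L] [Module (TriMat A M B) L]

theorem desc_id_apply (v : Column A M B (botPart A M B L)) :
    Column.desc LinearMap.id v = (structureMap A M B L v.top : L) + v.bot := by
  rw [Column.desc_apply]
  have : BimoduleTensor.map A M (LinearMap.id : botPart A M B L →ₗ[B] _) = LinearMap.id :=
    BimoduleTensor.hom_ext fun _ _ => rfl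
  rw [this]
  rfl

variable (A M B L) in
/-- The projection of `L` onto `(C, 0)`, where `C` is the cokernel of the structure map. -/
noncomputable def cokernelProj : L →ₗ[TriMat A M B] (inflTop A M B).obj
    (ModuleCat.of A (topPart A M B L ⧸ LinearMap.range (structureMap A M B L))) where
  toFun l := (LinearMap.range (structureMap A M B L)).mkQ (topProj A M B L l)
  map_add' l l' := by
    rw [map_add, map_add]
    rfl
  map_smul' x l := by
    have h : (LinearMap.range (structureMap A M B L)).mkQ
        (pairing A M B L x.m (botProj A M B L l)) = 0 :=
      (Submodule.Quotient.mk_eq_zero _).2 ⟨BimoduleTensor.tmul A B x.m _, rfl⟩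
    rw [topProj_smul, map_add, h, add_zero, map_smul]
    rfl

theorem cokernelProj_surjective : Function.Surjective (cokernelProj A M B L) := by
  intro c
  obtain ⟨x, rfl⟩ := Submodule.mkQ_surjective _ c
  refine ⟨(x : L), ?_⟩
  change Submodule.mkQ _ (topProj A M B L (x : L)) = _
  rw [topProj_coe_topPart]

theorem exact_desc_cokernelProj :
    Function.Exact (Column.desc (LinearMap.id : botPart A M B L →ₗ[B] _))
      (cokernelProj A M B L) := by
  intro l
  constructor
  · intro h
    obtain ⟨t, ht⟩ := (Submodule.Quotient.mk_eq_zero _).1 h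
    refine ⟨Column.mk t (botProj A M B L l), ?_⟩
    rw [desc_id_apply, Column.top_mk, Column.bot_mk, ht, topProj_add_botProj]
  · rintro ⟨v, rfl⟩
    refine (Submodule.Quotient.mk_eq_zero _).2 ⟨v.top, ?_⟩
    rw [desc_id_apply, map_add, topProj_coe_topPart, topProj_coe_botPart, add_zero]

theorem desc_id_injective (h : IsMonic A M B L) :
    Function.Injective (Column.desc (LinearMap.id : botPart A M B L →ₗ[B] _)) := by
  rw [injective_iff_map_eq_zero]
  intro v hv
  rw [desc_id_apply] at hv
  refine Column.ext ((injective_iff_map_eq_zero _).1 h _ ?_) ?_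
  · have := congrArg (topProj A M B L) hv
    rwa [map_add, topProj_coe_topPart, topProj_coe_botPart, add_zero, map_zero] at this
  · have := congrArg (botProj A M B L) hv
    rwa [map_add, botProj_coe_topPart, botProj_coe_botPart, zero_add, map_zero] at this

end Cokernel

section

variable {R : Type u} [CommRing R] [IsArtinianRing R] [Algebra R A] [Algebra R B] [Module R M]
  [IsScalarTower R A M] [IsScalarTower R Bᵐᵒᵖ M]

/-- The cokernel of the structure map of a monic semi-Gorenstein-projective module is
semi-Gorenstein-projective. -/
theorem isSemiGorensteinProjective_cokernel [IsNoetherianRing A] [IsNoetherianRing B]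
    [Module.Finite A M] (hM : projectiveDimension (ModuleCat.of A M) < ⊤)
    (H : ModuleCat.of B (ArtinDual R M) ∈ rightPerp B (leftPerp B (ModuleCat.of B B)))
    {L : ModuleCat.{u} (TriMat A M B)} (hL : IsSemiGorensteinProjective (TriMat A M B) L)
    (hmonic : IsMonic A M B L) :
    IsSemiGorensteinProjective A
      (ModuleCat.of A (topPart A M B L ⧸ LinearMap.range (structureMap A M B L))) := by
  obtain ⟨hfin, hY, hA⟩ := (isSemiGorensteinProjective_iff hM L).1 hL
  have h : ExtVanishes ((inflTop A M B).obj (ModuleCat.of A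
      (topPart A M B L ⧸ LinearMap.range (structureMap A M B L))))
      ((inflTop A M B).obj (ModuleCat.of A A)) :=
    ExtVanishes.of_exact_right (A := TriMat A M B)
      (X := (inflTop A M B).obj (ModuleCat.of A
        (topPart A M B L ⧸ LinearMap.range (structureMap A M B L))))
      (N := (inflTop A M B).obj (ModuleCat.of A A)) (desc_id_injective hmonic)
      exact_desc_cokernelProj cokernelProj_surjective
      (extVanishes_column_inflTop H hY (ModuleCat.of A A)) hA fun φ =>
        ⟨0, (LinearMap.zero_comp _).trans (eq_zero_of_column_inflTop _ φ).symm⟩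
  exact ⟨(finite_inflTop_iff (M := M) (B := B) _).1
      (Module.Finite.of_surjective _ (cokernelProj_surjective (L := L))),
    ((extVanishes_inflTop_iff _ _).1 h).of_iso_right
      (topFunctorInflTopIso M B (ModuleCat.of A A)).symm⟩

/-- If `A` and `B` are weakly Gorenstein and all semi-Gorenstein-projective modules over `Λ` are
monic, then `Λ` is weakly Gorenstein. A semi-Gorenstein-projective `L` is an extension of `(C, 0)`
by `(M ⊗_B Y, Y)`. Both of these are torsionless, and linear forms on the latter extend to `L`. -/
theorem isWeaklyGorenstein_of_isMonic [IsNoetherianRing A] [IsNoetherianRing B]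
    [IsNoetherianRing Bᵐᵒᵖ] [IsNoetherianRing (TriMat A M B)ᵐᵒᵖ]
    [Module.Finite A M] (hM : projectiveDimension (ModuleCat.of A M) < ⊤)
    (H : ModuleCat.of B (ArtinDual R M) ∈ rightPerp B (leftPerp B (ModuleCat.of B B)))
    (hmonic : ∀ L : ModuleCat.{u} (TriMat A M B),
      IsSemiGorensteinProjective (TriMat A M B) L → IsMonic A M B L)
    (hA : IsWeaklyGorenstein A) (hB : IsWeaklyGorenstein B) :
    IsWeaklyGorenstein (TriMat A M B) := by
  refine isWeaklyGorenstein_of_torsionless fun L hL => bidualMap_injective_iff.2 fun l hl => ?_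
  have hY := ((isSemiGorensteinProjective_iff hM L).1 hL).2.1
  have hC := isSemiGorensteinProjective_cokernel hM H hL (hmonic L hL)
  -- the image of `l` in the cokernel of the structure map is zero
  have hl0 : cokernelProj A M B L l = 0 := by
    refine bidualMap_injective_iff.1 (hA _ hC).2.2.1 _ fun f => ?_
    let f' : (inflTop A M B).obj (ModuleCat.of A
        (topPart A M B L ⧸ LinearMap.range (structureMap A M B L))) →ₗ[TriMat A M B]
        TriMat A M B :=
      (firstColumnRetract (A := A) (M := M) (B := B)).i.hom ∘ₗ
        ((inflTop A M B).map (ModuleCat.ofHom f)).hom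
    exact congrArg TriMat.a (hl (f' ∘ₗ cokernelProj A M B L))
  obtain ⟨v, rfl⟩ := (exact_desc_cokernelProj l).1 hl0
  -- linear forms on `(M ⊗_B Y, Y)` vanish at `v`, as they extend to `L`
  have hv (f : Column A M B (botPart A M B L) →ₗ[TriMat A M B] TriMat A M B) : f v = 0 := by
    obtain ⟨ψ, rfl⟩ := ExtVanishes.exists_linearMap_extension (desc_id_injective (hmonic L hL))
      exact_desc_cokernelProj cokernelProj_surjective
      (isSemiGorensteinProjective_inflTop (B := B) hM hC).2 f
    exact hl ψ
  -- a linear form `g` on `Y` gives the linear form `(t, y) ↦ ((M ⊗ g)(t), g(y))`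
  have key (g : botPart A M B L →ₗ[B] B) :
      BimoduleTensor.contract A M g v.top = 0 ∧ g v.bot = 0 := by
    let f : Column A M B (botPart A M B L) →ₗ[TriMat A M B] TriMat A M B :=
      { toFun := fun v => ⟨0, BimoduleTensor.contract A M g v.top, g v.bot⟩
        map_add' := fun v w => by ext <;> simp
        map_smul' := fun x v => by ext <;> simp [BimoduleTensor.contract_tmul] }
    exact ⟨congrArg TriMat.m (hv f), congrArg TriMat.b (hv f)⟩
  have htop : v.top = 0 := tensor_eq_zero_of_contract H hB hY fun g => (key g).1
  have hbot : v.bot = 0 := bidualMap_injective_iff.1 (hB _ hY).2.2.1 _ fun g => (key g).2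
  have hv0 : v = 0 := Column.ext htop hbot
  rw [hv0, map_zero]

/-- If `_AM` is torsionless and `B` is weakly Gorenstein, all semi-Gorenstein-projective modules
over `Λ` are monic. By `Ext¹_Λ(L, (A, 0)) = 0`, linear forms on the `A`-module `M ⊗_B e₂L` extend
along the structure map; and this module is torsionless. -/
theorem isMonic_of_isTorsionless [IsNoetherianRing A] [IsNoetherianRing B]
    [IsNoetherianRing Bᵐᵒᵖ] [Module.Finite A M]
    (hM : projectiveDimension (ModuleCat.of A M) < ⊤)
    (H : ModuleCat.of B (ArtinDual R M) ∈ rightPerp B (leftPerp B (ModuleCat.of B B)))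
    (hMt : IsTorsionless A M) (hB : IsWeaklyGorenstein B)
    {L : ModuleCat.{u} (TriMat A M B)} (hL : IsSemiGorensteinProjective (TriMat A M B) L) :
    IsMonic A M B L := by
  obtain ⟨hfin, hY, hA⟩ := (isSemiGorensteinProjective_iff hM L).1 hL
  rw [IsMonic, injective_iff_map_eq_zero]
  intro t ht
  -- the exact sequence `0 → (M ⊗_B Y, 0) → (M ⊗_B Y, Y) ⊕ (X, 0) → L → 0`
  let T : ModuleCat.{u} A := ModuleCat.of A (BimoduleTensor A M B (botPart A M B L))
  let X : ModuleCat.{u} A := ModuleCat.of A (topPart A M B L)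
  let i : (inflTop A M B).obj T →ₗ[TriMat A M B]
      Column A M B (botPart A M B L) × (inflTop A M B).obj X :=
    LinearMap.prod
      { toFun := fun t => Column.mk (show BimoduleTensor A M B (botPart A M B L) from t) 0
        map_add' := fun t t' => Column.ext rfl (add_zero (0 : botPart A M B L)).symm
        map_smul' := fun x t => by
          refine Column.ext (show _ = x.a • _ + BimoduleTensor.tmul A B x.m 0 from ?_)
            (smul_zero x.b).symm
          rw [BimoduleTensor.tmul_zero, add_zero]
          rfl }
      (-((inflTop A M B).map (ModuleCat.ofHom (structureMap A M B L))).hom)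
  let incl : (inflTop A M B).obj X →ₗ[TriMat A M B] L :=
    { toFun := fun x => (show topPart A M B L from x)
      map_add' := fun _ _ => rfl
      map_smul' := fun r x => (smul_coe_topPart r (show topPart A M B L from x)).symm }
  let q : Column A M B (botPart A M B L) × (inflTop A M B).obj X →ₗ[TriMat A M B] L :=
    LinearMap.coprod (Column.desc LinearMap.id) incl
  have hq (v : Column A M B (botPart A M B L)) (x : topPart A M B L) :
      q (v, (show (inflTop A M B).obj X from x)) =
        ((structureMap A M B L v.top + x : topPart A M B L) : L) + v.bot := by
    change Column.desc LinearMap.id v + (x : L) = _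
    rw [desc_id_apply, AddSubgroup.coe_add]
    abel
  have hi : Function.Injective i := fun t t' h =>
    congrArg (fun z : Column A M B (botPart A M B L) × (inflTop A M B).obj X => z.1.top) h
  have hiq : Function.Exact i q := by
    rintro ⟨v, x⟩
    constructor
    · intro h
      have h' := (hq v x).symm.trans h
      have h1 := congrArg (topProj A M B L) h'
      have h2 := congrArg (botProj A M B L) h'
      rw [map_add, topProj_coe_topPart, topProj_coe_botPart, add_zero, map_zero] at h1
      rw [map_add, botProj_coe_topPart, botProj_coe_botPart, zero_add, map_zero] at h2
      exact ⟨v.top, Prod.ext (Column.ext rfl h2.symm) (neg_eq_of_add_eq_zero_right h1)⟩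
    · rintro ⟨t, ht⟩
      rw [← ht]
      refine (hq (Column.mk t 0) (-structureMap A M B L t)).trans ?_
      exact (congrArg (· + (0 : L)) (congrArg Subtype.val
        (add_neg_cancel (structureMap A M B L t)))).trans (add_zero 0)
  have hqs : Function.Surjective q := fun l =>
    ⟨(Column.mk 0 (botProj A M B L l), (show (inflTop A M B).obj X from topProj A M B L l)), by
      rw [hq, Column.top_mk, Column.bot_mk, map_zero, zero_add, topProj_add_botProj]⟩
  -- linear forms on `M ⊗_B Y` vanish at `t`
  have key (χ : BimoduleTensor A M B (botPart A M B L) →ₗ[A] A) : χ t = 0 := by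
    have hext (N : ModuleCat.{u} (TriMat A M B)) (h : ExtVanishes L N) :=
      ExtVanishes.exists_linearMap_extension hi hiq hqs h
    obtain ⟨ψ, hψ⟩ := hext _ hA
      ((inflTop A M B).map (X := T) (ModuleCat.ofHom χ)).hom
    have h1 : ψ ∘ₗ LinearMap.inl (TriMat A M B) _ _ = 0 := eq_zero_of_column_inflTop _ _
    have h2 : i (show (inflTop A M B).obj T from t) = LinearMap.inl (TriMat A M B) _ _
        (Column.mk t 0) :=
      Prod.ext rfl ((congrArg Neg.neg ht).trans neg_zero)
    have h3 := LinearMap.congr_fun hψ (show (inflTop A M B).obj T from t)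
    rw [LinearMap.comp_apply, h2, ← LinearMap.comp_apply, h1] at h3
    exact h3.symm
  exact tensor_eq_zero_of_contract H hB hY fun g =>
    hMt.eq_zero_of_forall fun f => key (f ∘ₗ BimoduleTensor.contract A M g)

end

end TriMat

/-! ### The characterization of weakly Gorenstein triangular matrix algebras -/

theorem theorem1p2
    (R A B M : Type u) [CommRing R] [IsArtinianRing R]
    [Ring A] [Algebra R A] [Module.Finite R A]
    [Ring B] [Algebra R B] [Module.Finite R B]
    [AddCommGroup M] [Module R M] [Module.Finite R M]
    [Module A M] [Module Bᵐᵒᵖ M] [SMulCommClass A Bᵐᵒᵖ M]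
    [IsScalarTower R A M] [IsScalarTower R Bᵐᵒᵖ M]
    (hM : projectiveDimension (ModuleCat.of A M) < ⊤) :
    -- (1)
    (projectiveDimension (ModuleCat.of Bᵐᵒᵖ M) < ⊤ →
      ModuleCat.of B (ArtinDual R M) ∈ rightPerp B (leftPerp B (ModuleCat.of B B)) →
      (IsWeaklyGorenstein (TriMat A M B) ↔
        (∀ L : ModuleCat.{u} (TriMat A M B),
          IsSemiGorensteinProjective (TriMat A M B) L → TriMat.IsMonic A M B L) ∧
        IsWeaklyGorenstein A ∧ IsWeaklyGorenstein B)) ∧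
    -- (2)
    (projectiveDimension (ModuleCat.of Bᵐᵒᵖ M) < ⊤ →
      IsGorensteinAlgebra B →
      (IsWeaklyGorenstein (TriMat A M B) ↔
        (∀ L : ModuleCat.{u} (TriMat A M B),
          IsSemiGorensteinProjective (TriMat A M B) L → TriMat.IsMonic A M B L) ∧
        IsWeaklyGorenstein A)) ∧
    -- (3)
    (IsTorsionless A M → Module.Projective Bᵐᵒᵖ M →
      (IsWeaklyGorenstein (TriMat A M B) ↔ IsWeaklyGorenstein A ∧ IsWeaklyGorenstein B)) ∧
    -- (3), the case of a bimodule that is projective on both sides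
    (Module.Projective A M → Module.Projective Bᵐᵒᵖ M →
      (IsWeaklyGorenstein (TriMat A M B) ↔ IsWeaklyGorenstein A ∧ IsWeaklyGorenstein B)) := by
  have hA1 : IsNoetherianRing A := IsNoetherianRing.of_finite R A
  have hA2 : IsNoetherianRing Aᵐᵒᵖ := IsNoetherianRing.of_finite R Aᵐᵒᵖ
  have hB1 : IsNoetherianRing B := IsNoetherianRing.of_finite R B
  have hB2 : IsNoetherianRing Bᵐᵒᵖ := IsNoetherianRing.of_finite R Bᵐᵒᵖ
  have hΛ2 : IsNoetherianRing (TriMat A M B)ᵐᵒᵖ :=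
    IsNoetherianRing.of_finite R (TriMat A M B)ᵐᵒᵖ
  have hMA : Module.Finite A M := Module.Finite.of_restrictScalars_finite R A M
  have part₁ (H : ModuleCat.of B (ArtinDual R M) ∈ rightPerp B (leftPerp B (ModuleCat.of B B))) :
      IsWeaklyGorenstein (TriMat A M B) ↔
        (∀ L : ModuleCat.{u} (TriMat A M B),
          IsSemiGorensteinProjective (TriMat A M B) L → TriMat.IsMonic A M B L) ∧
        IsWeaklyGorenstein A ∧ IsWeaklyGorenstein B :=
    ⟨fun h => ⟨fun _ hL => TriMat.isMonic_of_isWeaklyGorenstein hM H h hL,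
      TriMat.isWeaklyGorenstein_top hM H h, TriMat.isWeaklyGorenstein_bot hM H h⟩,
    fun h => TriMat.isWeaklyGorenstein_of_isMonic hM H h.1 h.2.1 h.2.2⟩
  have part₃ (hMt : IsTorsionless A M) (hMB : Module.Projective Bᵐᵒᵖ M) :
      IsWeaklyGorenstein (TriMat A M B) ↔ IsWeaklyGorenstein A ∧ IsWeaklyGorenstein B := by
    have H := ArtinDual.mem_rightPerp_of_projective (R := R) (B := B) M
      (leftPerp B (ModuleCat.of B B))
    rw [part₁ H]
    exact ⟨fun h => h.2, fun h =>
      ⟨fun _ hL => TriMat.isMonic_of_isTorsionless hM H hMt h.2 hL, h⟩⟩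
  refine ⟨fun _ H => part₁ H, fun hMB hB => ?_, part₃, fun hMA hMB =>
    part₃ ⟨ModuleCat.of A M, LinearMap.id, hMA, Function.injective_id⟩ hMB⟩
  have hBW : IsWeaklyGorenstein B := isWeaklyGorenstein_of_injectiveDimension_op_lt_top hB.2
  obtain ⟨n, hn⟩ := exists_hasProjectiveDimensionLT_of_lt_top hMB
  rw [part₁ (ArtinDual.mem_rightPerp_of_isWeaklyGorenstein hBW n M hn)]
  exact ⟨fun h => ⟨h.1, h.2.1⟩, fun h => ⟨h.1, h.2, hBW⟩⟩
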